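/- Fix $k\ge 5$. For finite trees $R,T$ let $c(R,T)$ be the number of copies of $R$ in $T$, i.e. the number of subgraphs of $T$ isomorphic to $R$. Let $T_1^k,\dots,T_{N_k}^k$ be the isomorphism types of $k$-vertex trees, where $T_1^k$ is the path and $T_2^k$ is the star. The $k$-profile of a tree $T$ is the vector $p^{(k)}(T)\in\mathbb R^{N_k}$ with coordinates $p^{(k)}(T)_i=c(T_i^k,T)/\sum_{j=1}^{N_k}c(T_j^k,T)$. Let $\Delta_{\mathcal T}(k)$ be the set of all $p\in\mathbb R^{N_k}$ for which there is a sequence of trees $(T_n)$ with $|T_n|\to\infty$ and $p^{(k)}(T_n)\to p$, where $|T|$ denotes the number of vertices of $T$. **Theorem.** (1) If $k\ge 6$ and $p\in\Delta_{\mathcal T}(k)$, then $$p_2\ \ge\ 1-e\,(k-1)!\,(k-1)^{\varepsilon}\,p_1^{\,1-\frac{\varepsilon}{k-1}},\qquad \varepsilon=\frac{k-2+\sqrt{(k-2)^2+4(k-2)}}{2},$$ where $e$ is the base of the natural logarithm. (2) If $p\in\Delta_{\mathcal T}(5)$, then $$p_2\ \ge\ 1-p_1-2\cdot 4^{2+\sqrt3}\,p_1^{\frac{2-\sqrt3}{4}}.$$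 (3) In particular, let $k\ge5$ and let $(T_n)$ be a sequence of trees with $|T_n|\to\infty$. If $p^{(k)}(T_n)_1\to0$, then $p^{(k)}(T_n)_2\to1$. -/

import Mathlib

open Filter Topology
open scoped Nat

/-- A (finite) tree, on the vertex set `{0, …, order - 1}`; every finite tree is isomorphic to one
of these. -/
structure FinTree where
  order : ℕ
  graph : SimpleGraph (Fin order)
  isTree : graph.IsTree

/-- Isomorphism of trees on `k` labelled vertices. -/
def treeSetoid (k : ℕ) : Setoid {G : SimpleGraph (Fin k) // G.IsTree} where
  r G H := Nonempty (G.1 ≃g H.1)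
  iseqv :=
    { refl := fun _ => ⟨SimpleGraph.Iso.refl⟩
      symm := fun ⟨e⟩ => ⟨e.symm⟩
      trans := fun ⟨e⟩ ⟨f⟩ => ⟨e.trans f⟩ }

/-- The finite set of isomorphism types of `k`-vertex trees. -/
def TreeType (k : ℕ) : Type := Quotient (treeSetoid k)

instance (k : ℕ) : Finite (TreeType k) :=
  inferInstanceAs (Finite (Quotient (treeSetoid k)))

noncomputable instance (k : ℕ) : Fintype (TreeType k) := Fintype.ofFinite _

theorem copyCount_congr_iso {k : ℕ} (T : FinTree) {G H : SimpleGraph (Fin k)}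
    (h : Nonempty (G ≃g H)) : T.graph.copyCount G = T.graph.copyCount H := by
  classical
  obtain ⟨e⟩ := h
  unfold SimpleGraph.copyCount
  congr 1
  ext S
  simp only [Finset.mem_filter, Finset.mem_univ, true_and]
  exact ⟨fun ⟨f⟩ => ⟨e.symm.trans f⟩, fun ⟨f⟩ => ⟨e.trans f⟩⟩

/-- `copies R T` is the number of copies of the `k`-vertex tree `R` in `T`, that is, the number of
subgraphs of `T` isomorphic to `R`. -/
noncomputable def copies {k : ℕ} (R : TreeType k) (T : FinTree) : ℕ :=
  Quotient.lift (s := treeSetoid k)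
    (fun G : {G : SimpleGraph (Fin k) // G.IsTree} => T.graph.copyCount G.1)
    (fun _ _ h => copyCount_congr_iso T h) R

/-- The total number of `k`-vertex subtrees of `T`. -/
noncomputable def totalCopies (k : ℕ) (T : FinTree) : ℕ := ∑ R : TreeType k, copies R T

/-- The `k`-profile of `T`. -/
noncomputable def treeProfile (k : ℕ) (T : FinTree) : TreeType k → ℝ :=
  fun R => (copies R T : ℝ) / (totalCopies k T : ℝ)

/-- The set of limiting `k`-profiles of trees whose order tends to infinity. -/
def limitProfiles (k : ℕ) : Set (TreeType k → ℝ) :=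
  {p | ∃ T : ℕ → FinTree, Tendsto (fun n => (T n).order) atTop atTop ∧
    Tendsto (fun n => treeProfile k (T n)) atTop (𝓝 p)}

theorem isTree_pathGraph {k : ℕ} (hk : 0 < k) : (SimpleGraph.pathGraph k).IsTree := by
  obtain ⟨n, rfl⟩ : ∃ n, k = n + 1 := ⟨k - 1, by omega⟩
  have hc := SimpleGraph.pathGraph_connected n
  rw [SimpleGraph.isTree_iff_connected_and_card]
  refine ⟨hc, le_antisymm ?_ hc.card_vert_le_card_edgeSet_add_one⟩
  have hsub : (SimpleGraph.pathGraph (n + 1)).edgeSet ⊆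
      Set.range (fun i : Fin n => s(i.castSucc, i.succ)) := by
    intro e
    induction e using Sym2.ind with
    | _ u v =>
      intro h
      rw [SimpleGraph.mem_edgeSet, SimpleGraph.pathGraph_adj] at h
      rcases h with h | h
      · refine ⟨⟨u.1, by omega⟩, ?_⟩
        rw [Sym2.eq_iff]
        exact Or.inl ⟨rfl, Fin.ext h⟩
      · refine ⟨⟨v.1, by omega⟩, ?_⟩
        rw [Sym2.eq_iff]
        exact Or.inr ⟨rfl, Fin.ext h⟩
  have h1 := Nat.card_mono (Set.finite_range _) hsub
  have h2 := Finite.card_range_le (fun i : Fin n => s(i.castSucc, i.succ))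
  simp only [Nat.card_eq_fintype_card, Fintype.card_fin] at h2 ⊢
  simp only [Nat.card_eq_fintype_card] at h1
  omega

/-- The isomorphism type of the `k`-vertex path. -/
def pathType (k : ℕ) (hk : 0 < k) : TreeType k :=
  Quotient.mk (treeSetoid k) ⟨SimpleGraph.pathGraph k, isTree_pathGraph hk⟩

/-- The isomorphism type of the `k`-vertex star. -/
def starType (k : ℕ) (hk : 0 < k) : TreeType k :=
  Quotient.mk (treeSetoid k)
    ⟨SimpleGraph.starGraph (⟨0, hk⟩ : Fin k), SimpleGraph.isTree_starGraph _⟩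

/-- The exponent `ε` attached to `k`. -/
noncomputable def starExponent (k : ℕ) : ℝ :=
  ((k : ℝ) - 2 + √(((k : ℝ) - 2) ^ 2 + 4 * ((k : ℝ) - 2))) / 2

/-!
The number of `k`-vertex subtrees that are not stars is bounded by a moment of the numbers of
children whose order is smaller than the order `k - 1` that governs stars.

Write `n = k - 1`, root the tree `T` at a vertex, and let `c x` be the number of children of `x`.
Listing the vertices of a subtree by increasing depth turns it into a labelling of a rooted shape
`f` in which every vertex but the first is a child of an earlier one (`exists_labelling`), and the
subtree is a star unless `f` attaches some vertex to one other than the first. For such an `f`,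
the number of labellings is at most `E = ∑ x, c x ^ ε` as soon as `n - 1 ≤ ε` and `n ≤ ε + 1 / ε`
(`card_descents_le`). To see this, consider for each vertex `j` of the shape the function
`Q j = c (u j) ^ ε * ∏ 1 / c (u (f i))` of a labelling `u`, the product running over the edges that
are not on the way from the root of the shape to `j`. Its sum over all labellings is at most `E`,
since the label of `j` determines those above it and the other edges are averaged out
(`exists_sum_descents_le`); and a suitable convex combination of the `Q j` is at least `1`
everywhere, because `t ≥ 1 + log t`.

By Hölder's inequality `E ≤ N ^ (1 - ε / n) * (∑ x, c x ^ n) ^ (ε / n)`, where `N` is the order of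
`T`, and `∑ x, c x ^ n` is controlled by the number of stars `∑ x, (c x).choose n`. It remains to
compare `N` with the number of paths (`exists_order_le`). If the diameter is at least `2 * n`, then
every vertex is the end of a path with `n` edges running towards one of two given vertices, so `N`
is at most twice the number of paths. If the diameter is bounded, then `N` is negligible against the
number of stars as `N → ∞`. In the limit this gives
`1 - p₂ ≤ C * (2 * p₁) ^ (1 - ε / n) * (a + 2 * K * p₁) ^ (ε / n)`
(`one_sub_le_of_mem_limitProfiles`), where `C` bounds the number of shapes and `a`, `K` are any
constants with `c ^ n ≤ a * c.choose n + K` for all `c`. The explicit bounds follow because they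
are void unless `p₁` is small; for `k = 5` this leaves the freedom to take `a` close to `4! = 24`. The last
assertion follows from the bounds by compactness of the space of profiles.
-/

/-! ### Descending labellings -/

/-- For a forest given by its children map `C`, the labellings `u 0, …, u n` of a rooted tree of
shape `f` (vertex `i + 1` is attached to vertex `f i`) such that each `u (i + 1)` is a child of
`u (f i)`. A labelling is stored as a function on `ℕ` that is constant beyond `n`. -/
noncomputable def descents {V : Type*} [Fintype V] (C : V → Finset V) (f : ℕ → ℕ) :
    ℕ → Finset (ℕ → V)
  | 0 => by classical exact Finset.univ.image fun x _ => x
  | n + 1 => by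
    classical exact (descents C f n).biUnion fun u =>
      (C (u (f n))).image fun y => Function.update u (n + 1) y

section Descents

variable {V : Type*} [Fintype V] {C : V → Finset V} {f : ℕ → ℕ}

theorem sum_image_le_sum {α β : Type*} [DecidableEq β] (s : Finset α) (g : α → β) (Φ : β → ℝ)
    (hΦ : ∀ b, 0 ≤ Φ b) : ∑ b ∈ s.image g, Φ b ≤ ∑ a ∈ s, Φ (g a) := by
  rw [Finset.sum_comp Φ g]
  refine Finset.sum_le_sum fun b hb => ?_
  obtain ⟨a, ha, rfl⟩ := Finset.mem_image.1 hb
  have h1 : 1 ≤ (s.filter fun x => g x = g a).card :=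
    Finset.card_pos.2 ⟨a, Finset.mem_filter.2 ⟨ha, rfl⟩⟩
  have h2 : (1 : ℝ) ≤ (s.filter fun x => g x = g a).card := by exact_mod_cast h1
  rw [nsmul_eq_mul]
  nlinarith [hΦ (g a)]

theorem sum_descents_succ_le (n : ℕ) (Φ : (ℕ → V) → ℝ) (hΦ : ∀ u, 0 ≤ Φ u) :
    ∑ u ∈ descents C f (n + 1), Φ u ≤
      ∑ u ∈ descents C f n, ∑ y ∈ C (u (f n)), Φ (Function.update u (n + 1) y) := by
  classical
  have h : descents C f (n + 1) = ((descents C f n).sigma fun u => C (u (f n))).image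
      fun p => Function.update p.1 (n + 1) p.2 := by
    ext w
    simp only [descents, Finset.mem_biUnion, Finset.mem_image, Finset.mem_sigma, Sigma.exists]
    grind
  rw [h, Finset.sum_sigma']
  exact sum_image_le_sum _ _ _ hΦ

theorem sum_descents_zero_le (Φ : (ℕ → V) → ℝ) (hΦ : ∀ u, 0 ≤ Φ u) :
    ∑ u ∈ descents C f 0, Φ u ≤ ∑ x, Φ fun _ => x := by
  classical
  exact sum_image_le_sum _ _ _ hΦ

theorem descents_child (hf : ∀ i, f i ≤ i) {n : ℕ} {u : ℕ → V} (hu : u ∈ descents C f n) {i : ℕ}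
    (hi : i < n) : u (i + 1) ∈ C (u (f i)) := by
  classical
  induction n generalizing u with
  | zero => omega
  | succ n ih =>
    simp only [descents, Finset.mem_biUnion, Finset.mem_image] at hu
    obtain ⟨w, hw, y, hy, rfl⟩ := hu
    have hfi := hf i
    rw [Function.update_of_ne (by omega : f i ≠ n + 1)]
    rcases Nat.lt_succ_iff_lt_or_eq.1 hi with h | rfl
    · rw [Function.update_of_ne (by omega)]
      exact ih hw h
    · simpa using hy

theorem mem_descents (hf : ∀ i, f i ≤ i) {n : ℕ} {v : ℕ → V}
    (hv : ∀ i < n, v (i + 1) ∈ C (v (f i))) :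
    (fun m => if m ≤ n then v m else v 0) ∈ descents C f n := by
  classical
  induction n with
  | zero =>
    simp only [descents, Finset.mem_image, Finset.mem_univ, true_and]
    refine ⟨v 0, funext fun m => ?_⟩
    split_ifs with h
    · rw [Nat.le_zero.1 h]
    · rfl
  | succ n ih =>
    simp only [descents, Finset.mem_biUnion, Finset.mem_image]
    refine ⟨_, ih fun i hi => hv i (by omega), v (n + 1), ?_, funext fun m => ?_⟩
    · rw [if_pos (hf n)]
      exact hv n (by omega)
    · rcases eq_or_ne m (n + 1) with rfl | hm
      · simp
      · rw [Function.update_of_ne hm]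
        by_cases h : m ≤ n
        · rw [if_pos h, if_pos (by omega)]
        · rw [if_neg h, if_neg (by omega)]

/-- Fix a vertex `j` of the shape, and let `A` consist of the edges on the way from the root to
`j`. Choosing the label of `j` first forces the labels above it, and every edge outside `A` is
then chosen among the children of a known vertex, which the weights `1 / #children` average. -/
theorem exists_sum_descents_le (hf : ∀ i, f i ≤ i)
    (hC : ∀ x x' y, y ∈ C x → y ∈ C x' → x = x') (n j : ℕ) (hj : j ≤ n) :
    ∃ A ⊆ Finset.range n, (j ≠ 0 → ∃ i ∈ A, f i = 0) ∧ ∀ g : V → ℝ, (∀ x, 0 ≤ g x) →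
      ∑ u ∈ descents C f n, g (u j) * ∏ i ∈ Finset.range n \ A, ((C (u (f i))).card : ℝ)⁻¹ ≤
        ∑ x, g x := by
  classical
  induction n generalizing j with
  | zero =>
    refine ⟨∅, by simp, fun h => absurd (Nat.le_zero.1 hj) h, fun g hg => ?_⟩
    simpa using sum_descents_zero_le (C := C) (f := f) (fun u => g (u j)) fun u => hg _
  | succ n ih =>
    have hupd : ∀ (u : ℕ → V) (y : V) (m : ℕ), m ≤ n → Function.update u (n + 1) y m = u m :=
      fun u y m hm => Function.update_of_ne (by omega) _ _
    have hprod : ∀ (u : ℕ → V) (y : V) (B : Finset ℕ), B ⊆ Finset.range n →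
        ∏ i ∈ B, ((C (Function.update u (n + 1) y (f i))).card : ℝ)⁻¹ =
          ∏ i ∈ B, ((C (u (f i))).card : ℝ)⁻¹ := by
      intro u y B hB
      refine Finset.prod_congr rfl fun i hi => ?_
      have h1 := Finset.mem_range.1 (hB hi)
      have h2 := hf i
      rw [hupd u y _ (by omega)]
    rcases Nat.lt_succ_iff_lt_or_eq.1 (Nat.lt_succ_of_le hj) with hjn | rfl
    · obtain ⟨A, hA, h0, hsum⟩ := ih j (by omega)
      refine ⟨A, hA.trans (Finset.range_mono (by omega)), h0, fun g hg => ?_⟩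
      refine (sum_descents_succ_le n _ fun u => mul_nonneg (hg _)
        (Finset.prod_nonneg fun i _ => by positivity)).trans ?_
      refine le_trans (Finset.sum_le_sum fun u _ => ?_) (hsum g hg)
      have hsd : Finset.range (n + 1) \ A = insert n (Finset.range n \ A) := by
        ext m
        have := @hA n
        simp only [Finset.mem_sdiff, Finset.mem_range, Finset.mem_insert, lt_irrefl] at this ⊢
        grind
      have hnn : 0 ≤ g (u j) * ∏ i ∈ Finset.range n \ A, ((C (u (f i))).card : ℝ)⁻¹ :=
        mul_nonneg (hg _) (Finset.prod_nonneg fun i _ => by positivity)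
      have hterm : ∀ y ∈ C (u (f n)),
          g (Function.update u (n + 1) y j) * ∏ i ∈ Finset.range (n + 1) \ A,
            ((C (Function.update u (n + 1) y (f i))).card : ℝ)⁻¹ =
          ((C (u (f n))).card : ℝ)⁻¹ *
            (g (u j) * ∏ i ∈ Finset.range n \ A, ((C (u (f i))).card : ℝ)⁻¹) := by
        intro y _
        rw [hsd, Finset.prod_insert (by simp), hprod u y _ Finset.sdiff_subset,
          hupd u y _ (by omega), hupd u y _ (hf n)]
        ring
      rw [Finset.sum_congr rfl hterm, Finset.sum_const, nsmul_eq_mul, ← mul_assoc]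
      refine mul_le_of_le_one_left hnn ?_
      exact mul_inv_le_one
    · obtain ⟨A, hA, h0, hsum⟩ := ih (f n) (hf n)
      refine ⟨insert n A, ?_, fun _ => ?_, fun g hg => ?_⟩
      · intro m hm
        rcases Finset.mem_insert.1 hm with rfl | hm
        · simp
        · exact Finset.range_mono (by omega) (hA hm)
      · by_cases h : f n = 0
        · exact ⟨n, by simp, h⟩
        · obtain ⟨i, hi, hi0⟩ := h0 h
          exact ⟨i, by simp [hi], hi0⟩
      refine (sum_descents_succ_le n _ fun u => mul_nonneg (hg _)
        (Finset.prod_nonneg fun i _ => by positivity)).trans ?_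
      have hsd : Finset.range (n + 1) \ insert n A = Finset.range n \ A := by
        ext m
        simp only [Finset.mem_sdiff, Finset.mem_range, Finset.mem_insert]
        grind
      have hterm : ∀ u : ℕ → V, ∑ y ∈ C (u (f n)),
          (g (Function.update u (n + 1) y (n + 1)) * ∏ i ∈ Finset.range (n + 1) \ insert n A,
            ((C (Function.update u (n + 1) y (f i))).card : ℝ)⁻¹) =
          (∑ y ∈ C (u (f n)), g y) * ∏ i ∈ Finset.range n \ A, ((C (u (f i))).card : ℝ)⁻¹ := by
        intro u
        rw [hsd, Finset.sum_mul]
        refine Finset.sum_congr rfl fun y _ => ?_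
        rw [hprod u y _ Finset.sdiff_subset, Function.update_self]
      rw [Finset.sum_congr rfl fun u _ => hterm u]
      refine (hsum (fun x => ∑ y ∈ C x, g y) fun x => Finset.sum_nonneg fun y _ => hg y).trans ?_
      rw [← Finset.sum_biUnion fun x _ x' _ hne => Finset.disjoint_left.2 fun y hy hy' =>
        hne (hC x x' y hy hy')]
      exact Finset.sum_le_sum_of_subset_of_nonneg (Finset.subset_univ _) fun y _ _ => hg y

/-- Labellings of a shape other than the star rooted at its centre are bounded by a moment of the
numbers of children of order `ε`, which can be taken smaller than the number `n` of edges. -/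
theorem card_descents_le (hf : ∀ i, f i ≤ i) (hC : ∀ x x' y, y ∈ C x → y ∈ C x' → x = x') {n : ℕ}
    (hne : ∃ i < n, f i ≠ 0) {ε : ℝ} (hε0 : 0 < ε) (hε1 : (n : ℝ) - 1 ≤ ε)
    (hε : (n : ℝ) ≤ ε + 1 / ε) :
    ((descents C f n).card : ℝ) ≤ ∑ x, ((C x).card : ℝ) ^ ε := by
  classical
  have hf0 : f 0 = 0 := Nat.le_zero.1 (hf 0)
  have hn : 0 < n := by
    obtain ⟨i, hi, -⟩ := hne
    omega
  choose! A hA hA0 hsum using fun j (hj : j ≤ n) => exists_sum_descents_le hf hC n j hj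
  -- The convex combination gives `Q (f i)` the weight `1 / ε` for each `i ∈ B`, and `Q 0` the rest.
  set B := (Finset.range n).filter fun i => f i ≠ 0 with hB
  set E := ∑ x, ((C x).card : ℝ) ^ ε with hE
  set Q : ℕ → (ℕ → V) → ℝ := fun j u => ((C (u j)).card : ℝ) ^ ε *
    ∏ i ∈ Finset.range n \ A j, ((C (u (f i))).card : ℝ)⁻¹ with hQ
  have hQE : ∀ j ≤ n, ∑ u ∈ descents C f n, Q j u ≤ E := fun j hj =>
    hsum j hj (fun x => ((C x).card : ℝ) ^ ε) fun x => by positivity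
  have hB1 : 1 ≤ (B.card : ℝ) := by
    obtain ⟨i, hi, hi0⟩ := hne
    exact_mod_cast Finset.card_pos.2 ⟨i, by simp [hB, hi, hi0]⟩
  have hBn : (B.card : ℝ) ≤ n - 1 := by
    have h : B.card < (Finset.range n).card := Finset.card_lt_card <| by
      rw [Finset.ssubset_iff_of_subset (Finset.filter_subset _ _)]
      exact ⟨0, by simpa using hn, by simp [hf0]⟩
    rw [Finset.card_range] at h
    have : (B.card : ℝ) + 1 ≤ n := by exact_mod_cast h
    linarith
  have hw0 : 0 ≤ 1 - B.card / ε := by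
    rw [sub_nonneg, div_le_one hε0]
    linarith
  have hpt : ∀ u ∈ descents C f n,
      1 ≤ (1 - B.card / ε) * Q 0 u + 1 / ε * ∑ i ∈ B, Q (f i) u := by
    intro u hu
    set L : ℕ → ℝ := fun i => Real.log ((C (u (f i))).card : ℝ) with hL
    have hc : ∀ i < n, (1 : ℝ) ≤ ((C (u (f i))).card : ℝ) := fun i hi => by
      exact_mod_cast Finset.card_pos.2 ⟨_, descents_child hf hu hi⟩
    have hL0 : ∀ i < n, 0 ≤ L i := fun i hi => Real.log_nonneg (hc i hi)
    have hQL : ∀ i < n, 1 + (ε * L i - ∑ l ∈ Finset.range n \ A (f i), L l) ≤ Q (f i) u := by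
      intro i hi
      have hci : (0 : ℝ) < ((C (u (f i))).card : ℝ) := by linarith [hc i hi]
      have hpos : ∀ l ∈ Finset.range n \ A (f i), ((C (u (f l))).card : ℝ)⁻¹ ≠ 0 := by
        intro l hl
        have := hc l (Finset.mem_range.1 (Finset.mem_sdiff.1 hl).1)
        positivity
      have hprod : (0 : ℝ) < ∏ l ∈ Finset.range n \ A (f i), ((C (u (f l))).card : ℝ)⁻¹ :=
        lt_of_le_of_ne (Finset.prod_nonneg fun l _ => by positivity)
          (Finset.prod_ne_zero_iff.2 hpos).symm
      have hQp : 0 < Q (f i) u := mul_pos (by positivity) hprod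
      have h1 := Real.log_le_sub_one_of_pos hQp
      have h2 : Real.log (Q (f i) u) = ε * L i - ∑ l ∈ Finset.range n \ A (f i), L l := by
        rw [hQ]
        simp only
        rw [Real.log_mul (by positivity) hprod.ne', Real.log_rpow hci, Real.log_prod hpos,
          sub_eq_add_neg, ← Finset.sum_neg_distrib]
        simp [hL]
      linarith
    set S := ∑ l ∈ Finset.range n, L l with hS
    have hQ0 : 1 + (ε * L 0 - S) ≤ Q 0 u := by
      have h := hQL 0 hn
      rw [hf0] at h
      have : ∑ l ∈ Finset.range n \ A 0, L l ≤ S :=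
        Finset.sum_le_sum_of_subset_of_nonneg Finset.sdiff_subset fun l hl _ =>
          hL0 l (Finset.mem_range.1 hl)
      linarith
    -- The way from the root to `f i ≠ 0` uses an edge at the root, which saves a term `L 0`.
    have hQB : ∀ i ∈ B, 1 + (ε * L i - (S - L 0)) ≤ Q (f i) u := by
      intro i hi
      obtain ⟨hin, hi0⟩ := Finset.mem_filter.1 hi
      have hin := Finset.mem_range.1 hin
      have hfi := hf i
      obtain ⟨a, ha, ha0⟩ := hA0 (f i) (by omega) hi0
      have haL : L a = L 0 := by simp only [hL, ha0, hf0]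
      have h1 : ∑ l ∈ Finset.range n \ A (f i), L l + ∑ l ∈ A (f i), L l = S :=
        Finset.sum_sdiff (hA (f i) (by omega))
      have h2 : L a ≤ ∑ l ∈ A (f i), L l := Finset.single_le_sum
        (fun l hl => hL0 l (Finset.mem_range.1 (hA (f i) (by omega) hl))) ha
      linarith [hQL i hin]
    have hSB : S = ∑ i ∈ B, L i + (n - B.card) * L 0 := by
      rw [hS, ← Finset.sum_filter_add_sum_filter_not (Finset.range n) fun i => f i ≠ 0]
      congr 1
      have h1 : ∀ i ∈ (Finset.range n).filter (fun i => ¬ f i ≠ 0), L i = L 0 := by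
        intro i hi
        have := (Finset.mem_filter.1 hi).2
        simp only [hL, not_not.1 this, hf0]
      rw [Finset.sum_congr rfl h1, Finset.sum_const, nsmul_eq_mul]
      congr 1
      have h2 := Finset.card_filter_add_card_filter_not (s := Finset.range n) (fun i => f i ≠ 0)
      rw [Finset.card_range] at h2
      rw [eq_sub_iff_add_eq']
      exact_mod_cast h2
    have hsumB : B.card + (ε * ∑ i ∈ B, L i - B.card * (S - L 0)) ≤ ∑ i ∈ B, Q (f i) u := by
      refine le_trans (le_of_eq ?_) (Finset.sum_le_sum hQB)
      rw [Finset.sum_add_distrib, Finset.sum_sub_distrib, ← Finset.mul_sum]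
      simp only [Finset.sum_const, nsmul_eq_mul, mul_one]
    have hcoef : 0 ≤ (ε + B.card / ε - n) * L 0 := by
      refine mul_nonneg ?_ (hL0 0 hn)
      have : 1 / ε ≤ B.card / ε := by gcongr
      linarith
    have hkey : (1 - B.card / ε) * (1 + (ε * L 0 - S)) +
        1 / ε * (B.card + (ε * ∑ i ∈ B, L i - B.card * (S - L 0))) =
        1 + (ε + B.card / ε - n) * L 0 := by
      rw [hSB]
      field_simp
      ring
    have h3 := mul_le_mul_of_nonneg_left hQ0 hw0
    have h4 := mul_le_mul_of_nonneg_left hsumB (by positivity : 0 ≤ 1 / ε)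
    linarith
  calc ((descents C f n).card : ℝ) = ∑ u ∈ descents C f n, (1 : ℝ) := by simp
    _ ≤ ∑ u ∈ descents C f n, ((1 - B.card / ε) * Q 0 u + 1 / ε * ∑ i ∈ B, Q (f i) u) :=
        Finset.sum_le_sum hpt
    _ = (1 - B.card / ε) * ∑ u ∈ descents C f n, Q 0 u +
          1 / ε * ∑ i ∈ B, ∑ u ∈ descents C f n, Q (f i) u := by
        rw [Finset.sum_add_distrib, ← Finset.mul_sum, ← Finset.mul_sum, Finset.sum_comm]
    _ ≤ (1 - B.card / ε) * E + 1 / ε * ∑ i ∈ B, E := by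
        refine add_le_add (mul_le_mul_of_nonneg_left (hQE 0 (by omega)) hw0)
          (mul_le_mul_of_nonneg_left (Finset.sum_le_sum fun i hi => hQE _ ?_) (by positivity))
        have h1 := Finset.mem_range.1 (Finset.mem_filter.1 hi).1
        have h2 := hf i
        omega
    _ = E := by
        rw [Finset.sum_const, nsmul_eq_mul]
        field_simp
        ring

/-- Hölder's inequality between the moments of orders `0 ≤ ε ≤ n` of a function on `V`. -/
theorem sum_rpow_le {c : V → ℕ} {n : ℕ} {ε : ℝ} (hε : 0 < ε) (hεn : ε < n) :
    ∑ x, (c x : ℝ) ^ ε ≤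
      (Fintype.card V : ℝ) ^ (1 - ε / n) * (∑ x, (c x : ℝ) ^ n) ^ (ε / n) := by
  have hn : (0 : ℝ) < n := hε.trans hεn
  have hpq : ((n : ℝ) / ε).HolderConjugate (1 - ε / n)⁻¹ := by
    rw [Real.holderConjugate_iff]
    refine ⟨(one_lt_div hε).2 hεn, ?_⟩
    rw [inv_inv, inv_div]
    ring
  have h := Real.inner_le_Lp_mul_Lq_of_nonneg (s := Finset.univ) hpq
    (f := fun x => (c x : ℝ) ^ ε) (g := fun _ => (1 : ℝ)) (fun x _ => by positivity)
    (fun x _ => zero_le_one)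
  have hpow : ∀ x : V, ((c x : ℝ) ^ ε) ^ ((n : ℝ) / ε) = (c x : ℝ) ^ n := by
    intro x
    rw [← Real.rpow_mul (by positivity), mul_div_cancel₀ _ hε.ne', Real.rpow_natCast]
  simp only [mul_one, hpow, Real.one_rpow, Finset.sum_const, nsmul_eq_mul, Finset.card_univ,
    one_div, inv_inv, inv_div] at h
  rw [mul_comm]
  exact h

end Descents

/-! ### Rooted trees -/

section Rooted

variable {V : Type*} [Fintype V] {G : SimpleGraph V}

open Classical in
/-- The children of `x` when `G` is rooted at `r`: the neighbours of `x` that are farther from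
`r` than `x`. -/
noncomputable def children (G : SimpleGraph V) (r x : V) : Finset V :=
  Finset.univ.filter fun y => G.Adj x y ∧ G.dist r y = G.dist r x + 1

theorem mem_children {r x y : V} :
    y ∈ children G r x ↔ G.Adj x y ∧ G.dist r y = G.dist r x + 1 := by
  simp [children]

theorem mem_children_or_mem_children (hG : G.IsTree) (r : V) {x y : V} (h : G.Adj x y) :
    y ∈ children G r x ∨ x ∈ children G r y := by
  rcases hG.dist_eq_dist_add_one_of_adj r h with h' | h'
  · exact Or.inr (mem_children.2 ⟨h.symm, h'⟩)
  · exact Or.inl (mem_children.2 ⟨h, h'⟩)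

theorem eq_of_mem_children (hG : G.IsTree) {r : V} (x x' y : V) (h : y ∈ children G r x)
    (h' : y ∈ children G r x') : x = x' := by
  have key : ∀ z, y ∈ children G r z → ∃ p : G.Walk r y, p.IsPath ∧ p.penultimate = z := by
    intro z hz
    obtain ⟨hadj, hd⟩ := mem_children.1 hz
    obtain ⟨p, hp⟩ := hG.connected.exists_walk_length_eq_dist r z
    exact ⟨p.concat hadj, SimpleGraph.Walk.isPath_of_length_eq_dist _ (by simp [hp, hd]), by simp⟩
  obtain ⟨p, hp, rfl⟩ := key x h
  obtain ⟨q, hq, rfl⟩ := key x' h'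
  rw [(hG.existsUnique_path r y).unique hp hq]

theorem exists_mem_children (hG : G.IsTree) {r y : V} (hy : y ≠ r) : ∃ x, y ∈ children G r x := by
  obtain ⟨p, hp⟩ := hG.connected.exists_walk_length_eq_dist y r
  cases p with
  | nil => exact absurd rfl hy
  | @cons _ z _ hadj q =>
    refine ⟨z, (mem_children_or_mem_children hG r hadj).resolve_left fun hz => ?_⟩
    have h1 := (mem_children.1 hz).2
    have h2 := SimpleGraph.dist_le q
    rw [SimpleGraph.Walk.length_cons] at hp
    rw [SimpleGraph.dist_comm, SimpleGraph.dist_comm (u := r) (v := y)] at h1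
    omega

/-! ### Counting stars and paths from below -/

/-- Copies of `H` are counted from below by injective homomorphisms with distinct ranges `t i`. -/
theorem card_le_copyCount {W ι : Type*} {H : SimpleGraph W} (s : Finset ι) (t : ι → Set V)
    (ht : Set.InjOn t s)
    (h : ∀ i ∈ s, ∃ v : W → V, Function.Injective v ∧
      (∀ a b, H.Adj a b → G.Adj (v a) (v b)) ∧ Set.range v = t i) :
    s.card ≤ G.copyCount H := by
  classical
  have key : ∀ i ∈ s, ∃ S : G.Subgraph, Nonempty (H ≃g S.coe) ∧ S.verts = t i := by
    intro i hi
    obtain ⟨v, hv, hadj, hr⟩ := h i hi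
    let c : SimpleGraph.Copy H G := ⟨⟨v, fun {a b} => hadj a b⟩, hv⟩
    refine ⟨c.toSubgraph, ⟨c.isoToSubgraph⟩, ?_⟩
    rw [← hr]
    simp [SimpleGraph.Copy.toSubgraph, c]
  choose! S hS hSt using key
  unfold SimpleGraph.copyCount
  refine Finset.card_le_card_of_injOn S (fun i hi => ?_) fun i hi j hj hij => ?_
  · simpa using hS i hi
  · apply ht hi hj
    rw [← hSt i hi, ← hSt j hj, hij]

/-- The stars whose leaves are children of their centre: the vertex set determines the centre as
its top vertex. -/
theorem sum_choose_le_copyCount_starGraph (r : V) (n : ℕ) :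
    ∑ x, (children G r x).card.choose n ≤
      G.copyCount (SimpleGraph.starGraph (0 : Fin (n + 1))) := by
  classical
  have h : ∑ x, (children G r x).card.choose n = (Finset.univ.sigma fun x =>
      (children G r x).powersetCard n).card := by
    simp [Finset.card_sigma]
  rw [h]
  have hmem : ∀ p ∈ (Finset.univ.sigma fun x => (children G r x).powersetCard n),
      p.2 ⊆ children G r p.1 ∧ p.2.card = n := fun p hp =>
    Finset.mem_powersetCard.1 (Finset.mem_sigma.1 hp).2
  refine card_le_copyCount _ (fun p => insert p.1 (p.2 : Set V)) ?_ ?_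
  · rintro ⟨x, s⟩ hp ⟨x', s'⟩ hp' heq
    obtain ⟨hs, -⟩ := hmem _ hp
    obtain ⟨hs', -⟩ := hmem _ hp'
    dsimp only at hs hs' heq
    have hx : x = x' := by
      by_contra hne
      have h1 : x ∈ s' := by
        have : x ∈ insert x' (s' : Set V) := heq ▸ Set.mem_insert _ _
        exact_mod_cast this.resolve_left hne
      have h2 : x' ∈ s := by
        have : x' ∈ insert x (s : Set V) := heq ▸ Set.mem_insert _ _
        exact_mod_cast this.resolve_left (Ne.symm hne)
      have h3 := (mem_children.1 (hs' h1)).2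
      have h4 := (mem_children.1 (hs h2)).2
      omega
    subst hx
    have hx1 : x ∉ s := fun hx => by
      have := (mem_children.1 (hs hx)).2
      omega
    have hx2 : x ∉ s' := fun hx => by
      have := (mem_children.1 (hs' hx)).2
      omega
    have : s = s' := by
      ext y
      have h5 : y ∈ insert x (s : Set V) ↔ y ∈ insert x (s' : Set V) := by rw [heq]
      simp only [Set.mem_insert_iff, Finset.mem_coe] at h5
      grind
    rw [this]
  · rintro ⟨x, s⟩ hp
    obtain ⟨hs, hcard⟩ := hmem _ hp
    dsimp only at hs hcard ⊢
    let e := (s.equivFinOfCardEq hcard).symm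
    have hxs : x ∉ s := fun hx => by
      have := (mem_children.1 (hs hx)).2
      omega
    refine ⟨Fin.cons x fun i => (e i : V), ?_, ?_, ?_⟩
    · rw [Fin.cons_injective_iff]
      refine ⟨?_, Subtype.val_injective.comp e.injective⟩
      rintro ⟨i, hi⟩
      exact hxs (hi ▸ (e i).2)
    · have hadj : ∀ i : Fin n, G.Adj x (e i) := fun i => (mem_children.1 (hs (e i).2)).1
      intro a b hab
      rw [SimpleGraph.starGraph_adj] at hab
      obtain ⟨hne, rfl | rfl⟩ := hab
      · obtain ⟨j, rfl⟩ := Fin.exists_succ_eq.2 hne.symm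
        simpa using hadj j
      · obtain ⟨j, rfl⟩ := Fin.exists_succ_eq.2 hne
        simpa using (hadj j).symm
    · rw [Fin.range_cons]
      congr 1
      ext y
      constructor
      · rintro ⟨i, rfl⟩
        exact (e i).2
      · intro hy
        exact ⟨e.symm ⟨y, hy⟩, by simp⟩

/-- Every vertex at distance at least `n` from `r` is the lower end of a path with `n` edges that
runs towards `r`. -/
theorem card_filter_le_copyCount_pathGraph (hG : G.IsTree) (r : V) (n : ℕ)
    [DecidablePred fun x => n ≤ G.dist r x] :
    (Finset.univ.filter fun x => n ≤ G.dist r x).card ≤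
      G.copyCount (SimpleGraph.pathGraph (n + 1)) := by
  choose! par hpar using fun y (hy : y ≠ r) => exists_mem_children hG hy
  have hdist : ∀ x i, i ≤ G.dist r x → G.dist r (par^[i] x) + i = G.dist r x := by
    intro x i
    induction i with
    | zero => simp
    | succ i ih =>
      intro hi
      have h1 := ih (by omega)
      have hne : par^[i] x ≠ r := by
        intro h
        rw [h, SimpleGraph.dist_self] at h1
        omega
      have h2 := (mem_children.1 (hpar _ hne)).2
      rw [Function.iterate_succ_apply']
      omega
  have hadj : ∀ x i, i < G.dist r x → G.Adj (par^[i + 1] x) (par^[i] x) := by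
    intro x i hi
    have h1 := hdist x i hi.le
    have hne : par^[i] x ≠ r := by
      intro h
      rw [h, SimpleGraph.dist_self] at h1
      omega
    rw [Function.iterate_succ_apply']
    exact (mem_children.1 (hpar _ hne)).1
  refine card_le_copyCount _ (fun x => Set.range fun i : Fin (n + 1) => par^[i] x) ?_ ?_
  · intro x hx y hy hxy
    have hx : n ≤ G.dist r x := by simpa using hx
    have hy : n ≤ G.dist r y := by simpa using hy
    dsimp only at hxy
    have h1 : x ∈ Set.range fun i : Fin (n + 1) => par^[i] y := hxy ▸ ⟨0, rfl⟩
    have h2 : y ∈ Set.range fun i : Fin (n + 1) => par^[i] x := hxy ▸ ⟨0, rfl⟩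
    obtain ⟨i, hi⟩ := h1
    obtain ⟨j, hj⟩ := h2
    dsimp only at hi hj
    have h3 := hdist y i (by omega)
    have h4 := hdist x j (by omega)
    rw [hi] at h3
    rw [hj] at h4
    have : (i : ℕ) = 0 := by omega
    rw [this] at hi
    exact hi.symm
  · intro x hx
    have hx : n ≤ G.dist r x := by simpa using hx
    refine ⟨_, fun i j hij => ?_, fun i j hij => ?_, rfl⟩
    · have h3 := hdist x i (by omega)
      have h4 := hdist x j (by omega)
      rw [hij] at h3
      exact Fin.ext (by omega)
    · rw [SimpleGraph.pathGraph_adj] at hij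
      rcases hij with h | h
      · rw [← h]
        exact (hadj x i (by omega)).symm
      · rw [← h]
        exact hadj x j (by omega)

/-- In a tree of large diameter every vertex is far from one of two given vertices. -/
theorem card_le_two_mul_copyCount_pathGraph (hG : G.IsTree) {n : ℕ} {a b : V}
    (hab : 2 * n ≤ G.dist a b) :
    Fintype.card V ≤ 2 * G.copyCount (SimpleGraph.pathGraph (n + 1)) := by
  classical
  have h : (Finset.univ : Finset V) ⊆ (Finset.univ.filter fun x => n ≤ G.dist a x) ∪
      Finset.univ.filter fun x => n ≤ G.dist b x := by
    intro x _
    have := hG.connected.dist_triangle (u := a) (v := x) (w := b)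
    rw [SimpleGraph.dist_comm (u := x)] at this
    simp only [Finset.mem_union, Finset.mem_filter, Finset.mem_univ, true_and]
    omega
  have h1 := (Finset.card_le_card h).trans (Finset.card_union_le _ _)
  have h2 := card_filter_le_copyCount_pathGraph hG a n
  have h3 := card_filter_le_copyCount_pathGraph hG b n
  rw [Finset.card_univ] at h1
  omega

end Rooted

/-! ### The order of a tree is at most twice its number of long paths, or negligible -/

theorem card_level_succ_le {V : Type*} [Fintype V] [DecidableEq V] {G : SimpleGraph V}
    (hG : G.IsTree) (r : V) (i : ℕ) :
    (Finset.univ.filter fun x => G.dist r x = i + 1).card ≤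
      ∑ x ∈ Finset.univ.filter fun x => G.dist r x = i, (children G r x).card := by
  refine (Finset.card_le_card ?_).trans Finset.card_biUnion_le
  intro y hy
  have hy : G.dist r y = i + 1 := by simpa using hy
  have hne : y ≠ r := by
    rintro rfl
    simp at hy
  obtain ⟨x, hx⟩ := exists_mem_children hG hne
  have := (mem_children.1 hx).2
  exact Finset.mem_biUnion.2 ⟨x, by simp; omega, hx⟩

/-- For every fixed depth, the number of vertices at that depth is negligible against the `n`-th
moment of the numbers of children, up to a constant. -/
theorem exists_card_level_le {n : ℕ} (hn : 2 ≤ n) (i : ℕ) {δ : ℝ} (hδ : 0 < δ) :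
    ∃ K : ℝ, ∀ (T : FinTree) (r : Fin T.order),
      ((Finset.univ.filter fun x => T.graph.dist r x = i).card : ℝ) ≤
        K + δ * ∑ x, ((children T.graph r x).card : ℝ) ^ n := by
  induction i generalizing δ with
  | zero =>
    refine ⟨1, fun T r => ?_⟩
    have h1 : (Finset.univ.filter fun x => T.graph.dist r x = 0) = {r} := by
      ext x
      simp [T.isTree.connected.dist_eq_zero_iff, eq_comm]
    rw [h1]
    have : 0 ≤ δ * ∑ x, ((children T.graph r x).card : ℝ) ^ n := by positivity
    simpa using this
  | succ i ih =>
    set M : ℝ := max 1 (2 / δ) with hM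
    have hM1 : 1 ≤ M := le_max_left _ _
    have hM0 : 0 < M := by linarith
    have hMδ : 1 / M ≤ δ / 2 := by
      rw [div_le_div_iff₀ hM0 two_pos]
      have := le_max_right 1 (2 / δ)
      rw [div_le_iff₀ hδ] at this
      linarith
    obtain ⟨K, hK⟩ := ih (δ := δ / (2 * M)) (by positivity)
    refine ⟨M * K, fun T r => ?_⟩
    set Q := ∑ x, ((children T.graph r x).card : ℝ) ^ n with hQ
    have hQ0 : 0 ≤ Q := Finset.sum_nonneg fun x _ => by positivity
    -- A vertex with more than `M` children pays for them with `1 / M` of its `n`-th moment.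
    have hc : ∀ c : ℕ, (c : ℝ) ≤ M + 1 / M * (c : ℝ) ^ n := by
      intro c
      rcases le_total (c : ℝ) M with h | h
      · have : 0 ≤ 1 / M * (c : ℝ) ^ n := by positivity
        linarith
      · have h1 : (c : ℝ) ^ 2 ≤ (c : ℝ) ^ n := pow_le_pow_right₀ (by linarith) hn
        have h2 : (c : ℝ) ≤ 1 / M * (c : ℝ) ^ n := by
          rw [one_div, inv_mul_eq_div, le_div_iff₀ hM0]
          nlinarith
        linarith
    have h1 : ((Finset.univ.filter fun x => T.graph.dist r x = i + 1).card : ℝ) ≤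
        ∑ x ∈ Finset.univ.filter fun x => T.graph.dist r x = i,
          ((children T.graph r x).card : ℝ) := by
      exact_mod_cast card_level_succ_le T.isTree r i
    have h2 : ∑ x ∈ Finset.univ.filter fun x => T.graph.dist r x = i,
        ((children T.graph r x).card : ℝ) ≤
        (Finset.univ.filter fun x => T.graph.dist r x = i).card * M + 1 / M * Q := by
      refine (Finset.sum_le_sum fun x _ => hc _).trans ?_
      rw [Finset.sum_add_distrib, Finset.sum_const, nsmul_eq_mul, ← Finset.mul_sum]
      have h : ∑ x ∈ Finset.univ.filter fun x => T.graph.dist r x = i,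
          ((children T.graph r x).card : ℝ) ^ n ≤ Q :=
        Finset.sum_le_sum_of_subset_of_nonneg (Finset.filter_subset _ _) fun x _ _ => by positivity
      have h' : 0 ≤ 1 / M := by positivity
      exact add_le_add_right (mul_le_mul_of_nonneg_left h h') _
    have h3 := mul_le_mul_of_nonneg_right (hK T r) hM0.le
    have h4 : 1 / M * Q ≤ δ / 2 * Q := mul_le_mul_of_nonneg_right hMδ hQ0
    have h5 : (K + δ / (2 * M) * Q) * M = M * K + δ / 2 * Q := by
      field_simp
    linarith

/-- Up to an arbitrarily small proportion of the number of stars, the order of a large tree is at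
most twice its number of paths: by `card_le_two_mul_copyCount_pathGraph` if the diameter is large,
and by summing `exists_card_level_le` over all depths otherwise. -/
theorem exists_order_le {n : ℕ} (hn : 2 ≤ n) {a K : ℝ} (ha : 0 ≤ a) (hK : 0 ≤ K)
    (hc : ∀ c : ℕ, (c : ℝ) ^ n ≤ a * (c.choose n : ℝ) + K) {δ : ℝ} (hδ : 0 < δ) :
    ∃ N : ℕ, ∀ T : FinTree, N ≤ T.order → (T.order : ℝ) ≤
      2 * T.graph.copyCount (SimpleGraph.pathGraph (n + 1)) +
        δ * T.graph.copyCount (SimpleGraph.starGraph (0 : Fin (n + 1))) := by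
  set η : ℝ := min (1 / (4 * (K + 1))) (δ / (2 * (a + 1))) with hη
  have hη0 : 0 < η := lt_min (by positivity) (by positivity)
  choose L hL using fun i => exists_card_level_le hn i (δ := η / (2 * n)) (by positivity)
  set S := ∑ i ∈ Finset.range (2 * n), L i with hS
  refine ⟨max 1 ⌈4 * S⌉₊, fun T hT => ?_⟩
  have hord : 4 * S ≤ T.order :=
    (Nat.le_ceil _).trans (by exact_mod_cast (le_max_right _ _).trans hT)
  have hpos : 0 < T.order := (le_max_left _ _).trans hT
  let r : Fin T.order := ⟨0, hpos⟩
  by_cases hdiam : ∃ b, 2 * n ≤ T.graph.dist r b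
  · obtain ⟨b, hb⟩ := hdiam
    have h := card_le_two_mul_copyCount_pathGraph T.isTree hb
    rw [Fintype.card_fin] at h
    have h' : (T.order : ℝ) ≤ 2 * T.graph.copyCount (SimpleGraph.pathGraph (n + 1)) := by
      exact_mod_cast h
    have : 0 ≤ δ * T.graph.copyCount (SimpleGraph.starGraph (0 : Fin (n + 1))) := by positivity
    linarith
  · push Not at hdiam
    set Q := ∑ x, ((children T.graph r x).card : ℝ) ^ n with hQ
    set s : ℝ := ((T.graph.copyCount (SimpleGraph.starGraph (0 : Fin (n + 1))) : ℕ) : ℝ) with hs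
    have hlevels : T.order = ∑ i ∈ Finset.range (2 * n),
        (Finset.univ.filter fun x => T.graph.dist r x = i).card := by
      have h := Finset.card_eq_sum_card_fiberwise (s := Finset.univ)
        (f := fun x => T.graph.dist r x) (t := Finset.range (2 * n))
        (fun x _ => by simpa using hdiam x)
      rwa [Finset.card_univ, Fintype.card_fin] at h
    have h1 : (T.order : ℝ) ≤ S + η * Q := by
      have h2 : (T.order : ℝ) = ∑ i ∈ Finset.range (2 * n),
          ((Finset.univ.filter fun x => T.graph.dist r x = i).card : ℝ) := by exact_mod_cast hlevels
      rw [h2]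
      refine (Finset.sum_le_sum fun i _ => hL i T r).trans_eq ?_
      rw [Finset.sum_add_distrib, Finset.sum_const, Finset.card_range, nsmul_eq_mul]
      have : (n : ℝ) ≠ 0 := by
        have : 0 < n := by omega
        positivity
      have h3 : ((2 * n : ℕ) : ℝ) * (η / (2 * n) * Q) = η * Q := by
        push_cast
        field_simp
      rw [← hQ, h3]
    have h2 : Q ≤ a * s + K * T.order := by
      have h3 : (∑ x, ((children T.graph r x).card.choose n : ℝ)) ≤ s := by
        rw [hs, ← Nat.cast_sum]
        exact Nat.cast_le.2 <| sum_choose_le_copyCount_starGraph (G := T.graph) r n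
      calc Q ≤ ∑ x, (a * ((children T.graph r x).card.choose n : ℝ) + K) :=
            Finset.sum_le_sum fun x _ => hc _
        _ = a * ∑ x, ((children T.graph r x).card.choose n : ℝ) + K * T.order := by
            rw [Finset.sum_add_distrib, ← Finset.mul_sum, Finset.sum_const, Finset.card_univ,
              Fintype.card_fin, nsmul_eq_mul, mul_comm K]
        _ ≤ a * s + K * T.order := by gcongr
    have h3 : η * K ≤ 1 / 4 := by
      have h4 : η * (4 * (K + 1)) ≤ 1 := by
        rw [← le_div_iff₀ (by positivity)]
        exact min_le_left _ _
      nlinarith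
    have h4 : η * a ≤ δ / 2 := by
      have h5 : η * (2 * (a + 1)) ≤ δ := by
        rw [← le_div_iff₀ (by positivity)]
        exact min_le_right _ _
      nlinarith
    have hs0 : 0 ≤ s := by positivity
    have h5 : η * Q ≤ η * a * s + η * K * T.order := by
      refine (mul_le_mul_of_nonneg_left h2 hη0.le).trans_eq ?_
      ring
    have h6 : η * a * s ≤ δ / 2 * s := mul_le_mul_of_nonneg_right h4 hs0
    have h7 : η * K * T.order ≤ 1 / 4 * T.order :=
      mul_le_mul_of_nonneg_right h3 (Nat.cast_nonneg _)
    have : (0 : ℝ) ≤ T.graph.copyCount (SimpleGraph.pathGraph (n + 1)) := by positivity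
    linarith

/-! ### Labelling the subtrees by descents -/

section Labelling

variable {V : Type*} [Fintype V] {G : SimpleGraph V}

/-- A subtree of a rooted tree has a top vertex, and contains the parents of its other vertices. -/
theorem exists_top (hG : G.IsTree) (r : V) {S : G.Subgraph} (hS : S.coe.IsTree) :
    ∃ t ∈ S.verts, (∀ x ∈ S.verts, G.dist r t ≤ G.dist r x) ∧
      ∀ x ∈ S.verts, x ≠ t → ∃ z, S.Adj z x ∧ x ∈ children G r z := by
  classical
  have hne : Nonempty S.verts := hS.connected.nonempty
  obtain ⟨t, ht⟩ := Finite.exists_min fun x : S.verts => G.dist r x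
  refine ⟨t, t.2, fun x hx => ht ⟨x, hx⟩, ?_⟩
  -- Rooting `S` at `t` gives the same parents as rooting `G` at `r`: otherwise some `z` would have
  -- `x`, one of its children in `S`, as its parent in `G`, although by induction the parent of `z`
  -- in `G` is its parent in `S`.
  have key : ∀ (m : ℕ) (x z : S.verts), S.coe.dist t x = m → x ∈ children S.coe t z →
      (x : V) ∈ children G r z := by
    intro m
    induction m using Nat.strong_induction_on with
    | _ m ih =>
      intro x z hm hxz
      obtain ⟨hadj, hd⟩ := mem_children.1 hxz
      refine (mem_children_or_mem_children hG r (S.adj_sub hadj)).resolve_right fun hzx => ?_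
      have hdzx := (mem_children.1 hzx).2
      have hzt : z ≠ t := by
        rintro rfl
        have := ht x
        omega
      obtain ⟨w, hw⟩ := exists_mem_children hS hzt
      have hwx : w = x := Subtype.ext <|
        eq_of_mem_children hG _ _ _ (ih _ (by omega) z w rfl hw) hzx
      have := (mem_children.1 hw).2
      rw [hwx] at this
      omega
  intro x hx hxt
  obtain ⟨z, hz⟩ := exists_mem_children (y := ⟨x, hx⟩) hS (r := t) fun h => hxt (h ▸ rfl)
  exact ⟨z, (mem_children.1 hz).1, key _ _ _ rfl hz⟩

/-- Subtrees of a tree are induced subgraphs. -/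
theorem Subgraph.adj_of_isTree (hG : G.IsTree) {S : G.Subgraph} (hS : S.coe.IsTree) {x y : V}
    (hx : x ∈ S.verts) (hy : y ∈ S.verts) (h : G.Adj x y) : S.Adj x y := by
  obtain ⟨t, -, hmin, hpar⟩ := exists_top hG x hS
  have key : ∀ a b, a ∈ S.verts → b ∈ S.verts → b ∈ children G x a → S.Adj a b := by
    intro a b ha hb hab
    have hbt : b ≠ t := by
      rintro rfl
      have h1 := hmin a ha
      have h2 := (mem_children.1 hab).2
      omega
    obtain ⟨z, hz, hz'⟩ := hpar b hb hbt
    rwa [eq_of_mem_children hG _ _ _ hab hz']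
  rcases mem_children_or_mem_children hG x h with h' | h'
  · exact key x y hx hy h'
  · exact (key y x hy hx h').symm

theorem Subgraph.eq_of_verts_eq (hG : G.IsTree) {S S' : G.Subgraph} (hS : S.coe.IsTree)
    (hS' : S'.coe.IsTree) (h : S.verts = S'.verts) : S = S' := by
  refine SimpleGraph.Subgraph.ext h ?_
  funext x y
  refine propext ⟨fun hxy => ?_, fun hxy => ?_⟩
  · exact Subgraph.adj_of_isTree hG hS' (h ▸ S.edge_vert hxy) (h ▸ S.edge_vert hxy.symm)
      (S.adj_sub hxy)
  · exact Subgraph.adj_of_isTree hG hS (h ▸ S'.edge_vert hxy) (h ▸ S'.edge_vert hxy.symm)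
      (S'.adj_sub hxy)

/-- Listing the vertices of a subtree by increasing depth attaches each of them to an earlier one,
those attached to the top vertex first. -/
theorem exists_labelling (hG : G.IsTree) (r : V) {S : G.Subgraph} (hS : S.coe.IsTree) {n : ℕ}
    (hcard : Nat.card S.verts = n + 1) :
    ∃ (g : (i : Fin n) → Fin (i + 1)) (v : Fin (n + 1) → V),
      Set.range v = S.verts ∧
      (∀ i : Fin n, v i.succ ∈ children G r (v ((g i).castLE (by omega)))) ∧
      (∀ i j : Fin n, j ≤ i → g i = 0 → g j = 0) ∧
      ((∀ i, g i = 0) → Nonempty (SimpleGraph.starGraph (0 : Fin (n + 1)) ≃g S.coe)) := by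
  classical
  obtain ⟨t, htS, hmin, hpar⟩ := exists_top hG r hS
  let e₀ : Fin (n + 1) ≃ S.verts := (Finite.equivFinOfCardEq hcard).symm
  let e : Fin (n + 1) ≃ S.verts := (Tuple.sort fun i => G.dist r (e₀ i)).trans e₀
  have hmono : Monotone fun i => G.dist r (e i) := Tuple.monotone_sort fun i => G.dist r (e₀ i)
  have hsurj : ∀ x ∈ S.verts, ∃ i, (e i : V) = x := fun x hx => ⟨e.symm ⟨x, hx⟩, by simp⟩
  have hinj : ∀ i j, (e i : V) = e j → i = j := fun i j h => e.injective (Subtype.ext h)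
  have htop : ∀ i, G.dist r (e i) ≤ G.dist r (e 0) → i = 0 := by
    have h1 : ∀ i, G.dist r (e i) ≤ G.dist r (e 0) → (e i : V) = t := by
      intro i hi
      by_contra hit
      obtain ⟨z, hz, hz'⟩ := hpar _ (e i).2 hit
      obtain ⟨j, rfl⟩ := hsurj z (S.edge_vert hz)
      have h2 := (mem_children.1 hz').2
      have h3 := hmono (Fin.zero_le j)
      dsimp only at h3
      omega
    exact fun i hi => hinj _ _ ((h1 i hi).trans (h1 0 le_rfl).symm)
  have h0t : (e 0 : V) = t := by
    obtain ⟨i, hi⟩ := hsurj t htS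
    rw [← htop i (hi ▸ hmin _ (e 0).2)]
    exact hi
  have hstep : ∀ i : Fin n, ∃ j : Fin (i + 1),
      S.Adj (e (j.castLE (by omega))) (e i.succ) ∧
        (e i.succ : V) ∈ children G r (e (j.castLE (by omega))) := by
    intro i
    have hne : (e i.succ : V) ≠ t := fun h => (Fin.succ_ne_zero i) (hinj _ _ (h.trans h0t.symm))
    obtain ⟨z, hz, hz'⟩ := hpar _ (e i.succ).2 hne
    obtain ⟨j, rfl⟩ := hsurj z (S.edge_vert hz)
    have hlt : j < i.succ := by
      by_contra hle
      have h1 := hmono (not_lt.1 hle)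
      have h2 := (mem_children.1 hz').2
      dsimp only at h1
      omega
    exact ⟨⟨j, hlt⟩, hz, hz'⟩
  choose g hgS hg using hstep
  refine ⟨g, fun i => e i, ?_, hg, ?_, fun hstar => ?_⟩
  · ext x
    exact ⟨fun ⟨i, hi⟩ => hi ▸ (e i).2, hsurj x⟩
  · intro i j hji hi
    have h1 := hmono (Fin.succ_le_succ_iff.2 hji)
    have h2 := (mem_children.1 (hg i)).2
    have h3 := (mem_children.1 (hg j)).2
    have h4 : (Fin.castLE (by omega) (g i) : Fin (n + 1)) = 0 := by
      rw [hi]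
      rfl
    rw [h4] at h2
    dsimp only at h1
    have h5 := htop _ (by omega : G.dist r (e ((g j).castLE _)) ≤ _)
    have h6 := congrArg Fin.val h5
    exact Fin.ext h6
  · have hstar' : ∀ i : Fin n, (Fin.castLE (by omega) (g i) : Fin (n + 1)) = 0 := fun i => by
      rw [hstar i]
      rfl
    have hadj : ∀ i : Fin n, S.Adj (e 0) (e i.succ) := fun i => by
      have := hgS i
      rwa [hstar' i] at this
    have hchild : ∀ a b, (e b : V) ∈ children G r (e a) → a = 0 ∧ b ≠ 0 := by
      intro a b hab
      have hb : b ≠ 0 := by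
        rintro rfl
        have h1 := (mem_children.1 hab).2
        have h2 := hmono (Fin.zero_le a)
        dsimp only at h2
        omega
      obtain ⟨i, rfl⟩ := Fin.exists_succ_eq.2 hb
      have h1 := hg i
      rw [hstar' i] at h1
      exact ⟨hinj _ _ (eq_of_mem_children hG _ _ _ hab h1), hb⟩
    refine ⟨⟨e, ?_⟩⟩
    intro a b
    rw [SimpleGraph.Subgraph.coe_adj, SimpleGraph.starGraph_adj]
    constructor
    · intro h
      rcases mem_children_or_mem_children hG r (S.adj_sub h) with h' | h'
      · obtain ⟨rfl, hb⟩ := hchild _ _ h'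
        exact ⟨hb.symm, Or.inl rfl⟩
      · obtain ⟨rfl, ha⟩ := hchild _ _ h'
        exact ⟨ha, Or.inr rfl⟩
    · rintro ⟨hne, rfl | rfl⟩
      · obtain ⟨i, rfl⟩ := Fin.exists_succ_eq.2 hne.symm
        exact hadj i
      · obtain ⟨i, rfl⟩ := Fin.exists_succ_eq.2 hne
        exact (hadj i).symm

/-- The shapes of subtrees with `n` edges, as attachment maps: vertex `i + 1` is attached to vertex
`g i ≤ i`. The star with centre `0` is excluded, and the vertices attached to `0` come first. -/
def shapes (n : ℕ) : Finset ((i : Fin n) → Fin (i + 1)) :=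
  Finset.univ.filter fun g => (∃ i, g i ≠ 0) ∧ ∀ i j : Fin n, j ≤ i → g i = 0 → g j = 0

/-- An attachment map extended by `0` to `ℕ`. -/
def shapeFun {n : ℕ} (g : (i : Fin n) → Fin (i + 1)) (i : ℕ) : ℕ :=
  if h : i < n then g ⟨i, h⟩ else 0

theorem shapeFun_le {n : ℕ} (g : (i : Fin n) → Fin (i + 1)) (i : ℕ) : shapeFun g i ≤ i := by
  unfold shapeFun
  split_ifs with h
  · exact Nat.lt_succ_iff.1 (g ⟨i, h⟩).2
  · exact Nat.zero_le _

theorem card_shapes_le (n : ℕ) : (shapes n).card ≤ n ! := by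
  refine (Finset.card_le_univ _).trans_eq ?_
  rw [Fintype.card_pi]
  simp only [Fintype.card_fin]
  rw [Fin.prod_univ_eq_prod_range (fun i => i + 1), Finset.prod_range_add_one_eq_factorial]

/-- The constant of the bound for `k = 5` leaves room for little more than `15` shapes; the
condition that the vertices attached to `0` come first excludes enough of the `4! = 24` ones. -/
theorem card_shapes_four_le : (shapes 4).card ≤ 15 := by
  decide +kernel

/-- Subtrees with `n` edges that are not stars inject into the labellings of `shapes n`, because
the labels determine the vertex set and hence the subtree. -/
theorem card_filter_subgraph_le (hG : G.IsTree) (r : V) (n : ℕ) [Fintype G.Subgraph]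
    [DecidablePred fun S : G.Subgraph => S.coe.IsTree ∧ Nat.card S.verts = n + 1 ∧
      ¬ Nonempty (SimpleGraph.starGraph (0 : Fin (n + 1)) ≃g S.coe)] :
    (Finset.univ.filter fun S : G.Subgraph => S.coe.IsTree ∧ Nat.card S.verts = n + 1 ∧
      ¬ Nonempty (SimpleGraph.starGraph (0 : Fin (n + 1)) ≃g S.coe)).card ≤
      ∑ g ∈ shapes n, (descents (children G r) (shapeFun g) n).card := by
  have : Nonempty ((_ : (i : Fin n) → Fin (i + 1)) × (ℕ → V)) := ⟨⟨fun _ => 0, fun _ => r⟩⟩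
  have key : ∀ S : G.Subgraph, S.coe.IsTree ∧ Nat.card S.verts = n + 1 ∧
      ¬ Nonempty (SimpleGraph.starGraph (0 : Fin (n + 1)) ≃g S.coe) →
      ∃ p : (_ : (i : Fin n) → Fin (i + 1)) × (ℕ → V),
        p ∈ (shapes n).sigma (fun g => descents (children G r) (shapeFun g) n) ∧
        p.2 '' {m | m ≤ n} = S.verts := by
    rintro S ⟨hS, hcard, hstar⟩
    obtain ⟨g, v, hv, hchild, hmono, hg⟩ := exists_labelling hG r hS hcard
    set w : ℕ → V := fun m => if h : m < n + 1 then v ⟨m, h⟩ else v 0 with hw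
    refine ⟨⟨g, fun m => if m ≤ n then w m else w 0⟩, ?_, ?_⟩
    · rw [Finset.mem_sigma]
      constructor
      · simp only [shapes, Finset.mem_filter, Finset.mem_univ, true_and]
        refine ⟨?_, hmono⟩
        by_contra! h
        exact hstar (hg h)
      · refine mem_descents (v := w) (shapeFun_le g) fun i hi => ?_
        have h1 := hchild ⟨i, hi⟩
        have h2 : shapeFun g i < n + 1 := (shapeFun_le g i).trans_lt (by omega)
        have h3 : w (i + 1) = v (Fin.succ ⟨i, hi⟩) := by
          simp only [hw, dif_pos (show i + 1 < n + 1 by omega)]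
          rfl
        have h4 : w (shapeFun g i) = v ((g ⟨i, hi⟩).castLE (by simp; omega)) := by
          simp only [hw, dif_pos h2]
          congr 1
          apply Fin.ext
          simp [shapeFun, hi]
        rw [h3, h4]
        exact h1
    · rw [← hv]
      ext x
      constructor
      · rintro ⟨m, hm, rfl⟩
        have hm : m ≤ n := hm
        exact ⟨⟨m, by omega⟩, by simp [hw, hm]⟩
      · rintro ⟨i, rfl⟩
        exact ⟨i, Nat.lt_succ_iff.1 i.2, by simp [hw, Nat.lt_succ_iff.1 i.2]⟩
  choose! P hP hPv using key
  rw [← Finset.card_sigma]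
  refine Finset.card_le_card_of_injOn P (fun S hS => ?_) fun S hS S' hS' h => ?_
  · exact hP S (Finset.mem_filter.1 hS).2
  · have hS := (Finset.mem_filter.1 hS).2
    have hS' := (Finset.mem_filter.1 hS').2
    exact Subgraph.eq_of_verts_eq hG hS.1 hS'.1 (by rw [← hPv S hS, ← hPv S' hS', h])

end Labelling

/-! ### Profiles -/

theorem copies_eq_copyCount_out {k : ℕ} (R : TreeType k) (T : FinTree) :
    copies R T = T.graph.copyCount (Quotient.out R).1 := by
  conv_lhs => rw [← Quotient.out_eq R]
  rfl

theorem copies_starType (n : ℕ) (hk : 0 < n + 1) (T : FinTree) :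
    copies (starType (n + 1) hk) T =
      T.graph.copyCount (SimpleGraph.starGraph (0 : Fin (n + 1))) := rfl

theorem copies_pathType (n : ℕ) (hk : 0 < n + 1) (T : FinTree) :
    copies (pathType (n + 1) hk) T = T.graph.copyCount (SimpleGraph.pathGraph (n + 1)) := rfl

theorem copies_le_totalCopies {k : ℕ} (R : TreeType k) (T : FinTree) :
    copies R T ≤ totalCopies k T :=
  Finset.single_le_sum (f := fun R => copies R T) (fun _ _ => Nat.zero_le _) (Finset.mem_univ R)

theorem copyCount_eq_card_filter {V W : Type*} [Fintype V] (G : SimpleGraph V) (H : SimpleGraph W)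
    [DecidablePred fun S : G.Subgraph => Nonempty (H ≃g S.coe)] [Fintype G.Subgraph] :
    G.copyCount H = (Finset.univ.filter fun S : G.Subgraph => Nonempty (H ≃g S.coe)).card := by
  unfold SimpleGraph.copyCount
  convert rfl

theorem sum_card_filter_le {α β : Type*} [Fintype β] (s : Finset α) (P : α → β → Prop)
    (Q : β → Prop) [∀ a, DecidablePred (P a)] [DecidablePred Q]
    (hdisj : ∀ a a' b, P a b → P a' b → a = a') (hPQ : ∀ a ∈ s, ∀ b, P a b → Q b) :
    ∑ a ∈ s, (Finset.univ.filter (P a)).card ≤ (Finset.univ.filter Q).card := by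
  classical
  rw [← Finset.card_biUnion fun a _ a' _ hne => Finset.disjoint_left.2 fun b hb hb' =>
    hne (hdisj a a' b (Finset.mem_filter.1 hb).2 (Finset.mem_filter.1 hb').2)]
  refine Finset.card_le_card fun b hb => ?_
  obtain ⟨a, ha, hb⟩ := Finset.mem_biUnion.1 hb
  exact Finset.mem_filter.2 ⟨Finset.mem_univ _, hPQ a ha b (Finset.mem_filter.1 hb).2⟩

open Classical in
theorem totalCopies_le (n : ℕ) (hk : 0 < n + 1) (T : FinTree) (r : Fin T.order) :
    totalCopies (n + 1) T ≤ copies (starType (n + 1) hk) T +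
      ∑ g ∈ shapes n, (descents (children T.graph r) (shapeFun g) n).card := by
  unfold totalCopies
  rw [← Finset.add_sum_erase Finset.univ _ (Finset.mem_univ (starType (n + 1) hk))]
  refine Nat.add_le_add_left (le_trans ?_ (card_filter_subgraph_le T.isTree r n)) _
  have hcopies : ∀ R : TreeType (n + 1), copies R T = (Finset.univ.filter
      fun S : T.graph.Subgraph => Nonempty ((Quotient.out R).1 ≃g S.coe)).card := fun R => by
    rw [copies_eq_copyCount_out, copyCount_eq_card_filter]
  rw [Finset.sum_congr rfl fun R _ => hcopies R]
  refine sum_card_filter_le _ _ _ ?_ ?_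
  · rintro R R' S ⟨e⟩ ⟨e'⟩
    rw [← Quotient.out_eq R, ← Quotient.out_eq R']
    exact Quotient.sound ⟨e.trans e'.symm⟩
  · rintro R hR S ⟨e⟩
    refine ⟨e.isTree_iff.1 (Quotient.out R).2, ?_, ?_⟩
    · rw [← Nat.card_congr e.toEquiv]
      simp
    · rintro ⟨e'⟩
      refine (Finset.mem_erase.1 hR).1 ?_
      rw [← Quotient.out_eq R]
      exact Quotient.sound ⟨e.trans e'.symm⟩

section Bound

variable {n : ℕ} {ε a K C : ℝ}

/-- Hölder's inequality for the numbers of children of a tree with `x * Z` vertices, when `Z` bounds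
the number of stars. -/
theorem sum_rpow_le_mul {V : Type*} [Fintype V] {c : V → ℕ} (hε0 : 0 < ε) (hεn : ε < n)
    (ha : 0 ≤ a) (hK : 0 ≤ K) (hc : ∀ c : ℕ, (c : ℝ) ^ n ≤ a * (c.choose n : ℝ) + K) {x Z : ℝ}
    (hx0 : 0 ≤ x) (hZ : 0 < Z) (hx : (Fintype.card V : ℝ) ≤ x * Z)
    (hstar : ∑ y, ((c y).choose n : ℝ) ≤ Z) :
    ∑ y, (c y : ℝ) ^ ε ≤ x ^ (1 - ε / n) * (a + K * x) ^ (ε / n) * Z := by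
  have hn : (0 : ℝ) < n := hε0.trans hεn
  have hθ : 0 ≤ 1 - ε / n := by
    rw [sub_nonneg, div_le_one hn]
    exact hεn.le
  have hQ : ∑ y, (c y : ℝ) ^ n ≤ (a + K * x) * Z := by
    calc ∑ y, (c y : ℝ) ^ n ≤ ∑ y, (a * ((c y).choose n : ℝ) + K) :=
          Finset.sum_le_sum fun y _ => hc _
      _ = a * ∑ y, ((c y).choose n : ℝ) + K * Fintype.card V := by
          rw [Finset.sum_add_distrib, ← Finset.mul_sum, Finset.sum_const, Finset.card_univ,
            nsmul_eq_mul, mul_comm K]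
      _ ≤ a * Z + K * (x * Z) := by gcongr
      _ = (a + K * x) * Z := by ring
  have hQ0 : 0 ≤ ∑ y, (c y : ℝ) ^ n := Finset.sum_nonneg fun y _ => by positivity
  calc ∑ y, (c y : ℝ) ^ ε
      ≤ (Fintype.card V : ℝ) ^ (1 - ε / n) * (∑ y, (c y : ℝ) ^ n) ^ (ε / n) :=
        sum_rpow_le hε0 hεn
    _ ≤ (x * Z) ^ (1 - ε / n) * ((a + K * x) * Z) ^ (ε / n) := by gcongr
    _ = x ^ (1 - ε / n) * (a + K * x) ^ (ε / n) * (Z ^ (1 - ε / n) * Z ^ (ε / n)) := by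
        rw [Real.mul_rpow hx0 hZ.le, Real.mul_rpow (by positivity) hZ.le]
        ring
    _ = x ^ (1 - ε / n) * (a + K * x) ^ (ε / n) * Z := by
        rw [← Real.rpow_add hZ, sub_add_cancel, Real.rpow_one]

theorem totalCopies_le_add_mul_sum_rpow (hε0 : 0 < ε) (hε1 : (n : ℝ) - 1 ≤ ε)
    (hε : (n : ℝ) ≤ ε + 1 / ε) (hC : ((shapes n).card : ℝ) ≤ C) (hk : 0 < n + 1) (T : FinTree)
    (r : Fin T.order) :
    (totalCopies (n + 1) T : ℝ) ≤ copies (starType (n + 1) hk) T +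
      C * ∑ y, ((children T.graph r y).card : ℝ) ^ ε := by
  have h1 : (totalCopies (n + 1) T : ℝ) ≤ copies (starType (n + 1) hk) T +
      ∑ g ∈ shapes n, ((descents (children T.graph r) (shapeFun g) n).card : ℝ) := by
    rw [← Nat.cast_sum, ← Nat.cast_add]
    exact Nat.cast_le.2 (totalCopies_le n hk T r)
  have h2 : ∀ g ∈ shapes n, ((descents (children T.graph r) (shapeFun g) n).card : ℝ) ≤
      ∑ y, ((children T.graph r y).card : ℝ) ^ ε := by
    intro g hg
    obtain ⟨i, hi⟩ := (Finset.mem_filter.1 hg).2.1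
    refine card_descents_le (shapeFun_le g) (eq_of_mem_children T.isTree) ⟨i, i.2, ?_⟩ hε0 hε1 hε
    rw [shapeFun, dif_pos i.2]
    exact fun h => hi (Fin.ext h)
  have h3 := Finset.sum_le_sum h2
  rw [Finset.sum_const, nsmul_eq_mul] at h3
  exact h1.trans <| add_le_add_right (h3.trans <| mul_le_mul_of_nonneg_right hC <|
    Finset.sum_nonneg fun y _ => Real.rpow_nonneg (Nat.cast_nonneg _) _) _

theorem one_sub_treeProfile_le (hε0 : 0 < ε) (hε1 : (n : ℝ) - 1 ≤ ε) (hεn : ε < n)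
    (hε : (n : ℝ) ≤ ε + 1 / ε) (ha : 0 ≤ a) (hK : 0 ≤ K)
    (hc : ∀ c : ℕ, (c : ℝ) ^ n ≤ a * (c.choose n : ℝ) + K) (hC : ((shapes n).card : ℝ) ≤ C)
    (hk : 0 < n + 1) {T : FinTree} (hT : 0 < T.order) (hZ : 0 < totalCopies (n + 1) T) {x : ℝ}
    (hx : (T.order : ℝ) ≤ x * totalCopies (n + 1) T) :
    1 - treeProfile (n + 1) T (starType (n + 1) hk) ≤
      C * (x ^ (1 - ε / n) * (a + K * x) ^ (ε / n)) := by
  have hZ' : (0 : ℝ) < totalCopies (n + 1) T := Nat.cast_pos.2 hZ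
  have hx0 : 0 ≤ x := by
    by_contra! h
    have h1 : x * totalCopies (n + 1) T < 0 := mul_neg_of_neg_of_pos h hZ'
    have h2 : (0 : ℝ) ≤ T.order := Nat.cast_nonneg _
    linarith
  have hC0 : 0 ≤ C := (Nat.cast_nonneg _).trans hC
  have hstar : ∑ y, ((children T.graph ⟨0, hT⟩ y).card.choose n : ℝ) ≤
      totalCopies (n + 1) T := by
    rw [← Nat.cast_sum]
    refine Nat.cast_le.2 ((sum_choose_le_copyCount_starGraph (G := T.graph) _ n).trans ?_)
    rw [← copies_starType n hk T]
    exact copies_le_totalCopies _ T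
  have hE := sum_rpow_le_mul hε0 hεn ha hK hc hx0 hZ' (by rwa [Fintype.card_fin]) hstar
  have hF := totalCopies_le_add_mul_sum_rpow hε0 hε1 hε hC hk T ⟨0, hT⟩
  have h5 := mul_le_mul_of_nonneg_left hE hC0
  unfold treeProfile
  rw [sub_le_iff_le_add, ← sub_le_iff_le_add', le_div_iff₀ hZ', sub_mul, one_mul]
  linarith

theorem limitProfiles_nonneg {k : ℕ} {p : TreeType k → ℝ} (hp : p ∈ limitProfiles k)
    (R : TreeType k) : 0 ≤ p R := by
  obtain ⟨T, -, hT⟩ := hp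
  refine ge_of_tendsto' (tendsto_pi_nhds.1 hT R) fun m => ?_
  unfold treeProfile
  positivity

theorem treeProfile_le_one {k : ℕ} (T : FinTree) (R : TreeType k) : treeProfile k T R ≤ 1 :=
  div_le_one_of_le₀ (Nat.cast_le.2 (copies_le_totalCopies R T)) (Nat.cast_nonneg _)

theorem limitProfiles_le_one {k : ℕ} {p : TreeType k → ℝ} (hp : p ∈ limitProfiles k)
    (R : TreeType k) : p R ≤ 1 := by
  obtain ⟨T, -, hT⟩ := hp
  exact le_of_tendsto' (tendsto_pi_nhds.1 hT R) fun m => treeProfile_le_one _ _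

/-- The bound on limiting profiles from which the explicit ones are read off. -/
theorem one_sub_le_of_mem_limitProfiles (hn : 2 ≤ n) (hε0 : 0 < ε) (hε1 : (n : ℝ) - 1 ≤ ε)
    (hεn : ε < n) (hε : (n : ℝ) ≤ ε + 1 / ε) (ha : 0 ≤ a) (hK : 0 ≤ K)
    (hc : ∀ c : ℕ, (c : ℝ) ^ n ≤ a * (c.choose n : ℝ) + K) (hC : ((shapes n).card : ℝ) ≤ C)
    (hk : 0 < n + 1) {p : TreeType (n + 1) → ℝ} (hp : p ∈ limitProfiles (n + 1)) :
    1 - p (starType (n + 1) hk) ≤ C * ((2 * p (pathType (n + 1) hk)) ^ (1 - ε / n) *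
      (a + K * (2 * p (pathType (n + 1) hk))) ^ (ε / n)) := by
  obtain ⟨T, hord, hT⟩ := hp
  have hn0 : (0 : ℝ) < n := hε0.trans hεn
  have hθ : 0 ≤ 1 - ε / n := by
    rw [sub_nonneg, div_le_one hn0]
    exact hεn.le
  set h : ℝ → ℝ := fun x => C * (x ^ (1 - ε / n) * (a + K * x) ^ (ε / n)) with hh
  have hcont : Continuous h := by
    refine continuous_const.mul ((Real.continuous_rpow_const hθ).mul ?_)
    exact (Real.continuous_rpow_const (by positivity)).comp (by fun_prop)
  have hstar := tendsto_pi_nhds.1 hT (starType (n + 1) hk)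
  have hpath := tendsto_pi_nhds.1 hT (pathType (n + 1) hk)
  have hδ : ∀ δ : ℝ, 0 < δ →
      1 - p (starType (n + 1) hk) ≤ h (2 * p (pathType (n + 1) hk) + δ) := by
    intro δ hδ
    obtain ⟨N, hN⟩ := exists_order_le hn ha hK hc hδ
    refine le_of_tendsto_of_tendsto (hstar.const_sub 1)
      ((hcont.tendsto _).comp ((hpath.const_mul 2).add_const δ)) ?_
    filter_upwards [hord.eventually_ge_atTop (max 1 N)] with m hm
    have hm1 : 0 < (T m).order := (le_max_left _ _).trans hm
    have h1 := hN (T m) ((le_max_right _ _).trans hm)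
    rw [← copies_starType n hk, ← copies_pathType n hk] at h1
    have hS : (copies (starType (n + 1) hk) (T m) : ℝ) ≤ totalCopies (n + 1) (T m) :=
      Nat.cast_le.2 (copies_le_totalCopies _ _)
    have hP : (copies (pathType (n + 1) hk) (T m) : ℝ) ≤ totalCopies (n + 1) (T m) :=
      Nat.cast_le.2 (copies_le_totalCopies _ _)
    have hZ : 0 < totalCopies (n + 1) (T m) := by
      by_contra h0
      have h0 : totalCopies (n + 1) (T m) = 0 := by omega
      rw [h0, Nat.cast_zero] at hS hP
      have h2 : (0 : ℝ) < (T m).order := Nat.cast_pos.2 hm1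
      have h3 : δ * (copies (starType (n + 1) hk) (T m) : ℝ) ≤ 0 :=
        mul_nonpos_of_nonneg_of_nonpos hδ.le hS
      linarith
    refine one_sub_treeProfile_le hε0 hε1 hεn hε ha hK hc hC hk hm1 hZ ?_
    have hZ' : (0 : ℝ) < totalCopies (n + 1) (T m) := Nat.cast_pos.2 hZ
    have h4 : treeProfile (n + 1) (T m) (pathType (n + 1) hk) * totalCopies (n + 1) (T m) =
        copies (pathType (n + 1) hk) (T m) := div_mul_cancel₀ _ hZ'.ne'
    have h5 := mul_le_mul_of_nonneg_left hS hδ.le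
    rw [add_mul, mul_assoc, h4]
    linarith
  have hlim : Tendsto (fun δ : ℝ => h (2 * p (pathType (n + 1) hk) + δ)) (𝓝[>] 0)
      (𝓝 (h (2 * p (pathType (n + 1) hk)))) := by
    have h1 : Continuous fun δ : ℝ => h (2 * p (pathType (n + 1) hk) + δ) := by fun_prop
    have h2 := h1.tendsto 0
    rw [add_zero] at h2
    exact h2.mono_left nhdsWithin_le_nhds
  exact ge_of_tendsto hlim (eventually_nhdsWithin_of_forall fun δ hδ' => hδ δ hδ')

end Bound

/-! ### The explicit bounds -/

theorem pow_le_pow_self_mul_choose_add (n c : ℕ) :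
    (c : ℝ) ^ n ≤ (n : ℝ) ^ n * (c.choose n : ℝ) + (n : ℝ) ^ n := by
  have key : c ^ n ≤ n ^ n * c.choose n + n ^ n := by
    rcases le_total c n with h | h
    · exact (Nat.pow_le_pow_left h n).trans (Nat.le_add_left _ _)
    · refine le_trans ?_ (Nat.le_add_right _ _)
      have h1 : c ^ n * n ! ≤ n ^ n * c.descFactorial n := by
        rw [← Nat.descFactorial_self n, Nat.descFactorial_eq_prod_range,
          Nat.descFactorial_eq_prod_range]
        calc c ^ n * ∏ i ∈ Finset.range n, (n - i) = ∏ i ∈ Finset.range n, c * (n - i) := by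
              rw [Finset.prod_mul_distrib]
              simp
          _ ≤ ∏ i ∈ Finset.range n, n * (c - i) := by
              refine Finset.prod_le_prod' fun i _ => ?_
              rw [Nat.mul_sub, Nat.mul_sub, mul_comm c n]
              exact Nat.sub_le_sub_left (Nat.mul_le_mul_right i h) _
          _ = n ^ n * ∏ i ∈ Finset.range n, (c - i) := by
              rw [Finset.prod_mul_distrib]
              simp
      rw [Nat.descFactorial_eq_factorial_mul_choose] at h1
      refine Nat.le_of_mul_le_mul_right ?_ (Nat.factorial_pos n)
      calc c ^ n * n ! ≤ n ^ n * (n ! * c.choose n) := h1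
        _ = n ^ n * c.choose n * n ! := by ring
  exact_mod_cast key

theorem pow_four_le_choose_add (c : ℕ) :
    (c : ℝ) ^ 4 ≤ 25 * (c.choose 4 : ℝ) + 300 ^ 4 := by
  rcases le_total c 300 with h | h
  · have h1 : (c : ℝ) ^ 4 ≤ 300 ^ 4 := by
      gcongr
      exact_mod_cast h
    have h2 : (0 : ℝ) ≤ c.choose 4 := Nat.cast_nonneg _
    linarith
  · have h1 : ((c + 1 - 4 : ℕ) : ℝ) ^ 4 ≤ 24 * (c.choose 4 : ℝ) := by
      have h := Nat.pow_le_choose (α := ℝ) 4 c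
      rw [div_le_iff₀ (by positivity)] at h
      norm_num [Nat.factorial] at h ⊢
      linarith
    have h2 : ((c + 1 - 4 : ℕ) : ℝ) = (c : ℝ) - 3 := by
      rw [Nat.cast_sub (by omega)]
      push_cast
      ring
    have h3 : (300 : ℝ) ≤ c := by exact_mod_cast h
    have h4 : (99 / 100 * (c : ℝ)) ^ 4 ≤ ((c : ℝ) - 3) ^ 4 := by
      gcongr
      linarith
    rw [h2] at h1
    nlinarith [pow_nonneg (Nat.cast_nonneg c : (0 : ℝ) ≤ c) 4]

/-- The explicit bound for `k ≥ 6`; `starExponent k` exceeds the smallest exponent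
allowed by `card_descents_le`. -/
theorem starType_ge_of_six_le {k : ℕ} (hk : 6 ≤ k) (hk0 : 0 < k) {p : TreeType k → ℝ}
    (hp : p ∈ limitProfiles k) :
    p (starType k hk0) ≥
      1 - Real.exp 1 * ((k - 1)! : ℝ) * ((k : ℝ) - 1) ^ starExponent k *
        p (pathType k hk0) ^ (1 - starExponent k / ((k : ℝ) - 1)) := by
  obtain ⟨n, rfl⟩ : ∃ n, k = n + 1 := ⟨k - 1, by omega⟩
  have hn5 : (5 : ℝ) ≤ n := by
    have : 5 ≤ n := by omega
    exact_mod_cast this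
  have hcast : ((n + 1 : ℕ) : ℝ) - 1 = n := by
    push_cast
    ring
  obtain ⟨ε, hε⟩ : ∃ ε, ε = starExponent (n + 1) := ⟨_, rfl⟩
  rw [← hε, hcast, Nat.add_sub_cancel]
  set s := √(((n : ℝ) - 1) ^ 2 + 4 * (n - 1)) with hs
  have hεs : ε = ((n : ℝ) - 1 + s) / 2 := by
    rw [hε, starExponent, hs]
    push_cast
    ring_nf
  have hs2 : s ^ 2 = ((n : ℝ) - 1) ^ 2 + 4 * (n - 1) := Real.sq_sqrt (by nlinarith)
  have hs0 : 0 ≤ s := Real.sqrt_nonneg _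
  have hs1 : (n : ℝ) - 1 ≤ s := Real.le_sqrt_of_sq_le (by linarith)
  have hs3 : s < n + 1 := by nlinarith
  have hε1 : (n : ℝ) - 1 ≤ ε := by linarith
  have hε0 : 0 < ε := by linarith
  have hεn : ε < n := by linarith
  have hεq : (n : ℝ) ≤ ε + 1 / ε := by
    have h1 : ε ^ 2 = (n - 1) * ε + (n - 1) := by
      rw [hεs]
      nlinarith
    have h2 : (n - ε) * ε ≤ 1 := by nlinarith
    rw [← le_div_iff₀ hε0] at h2
    linarith
  have hn0 : (0 : ℝ) < n := by linarith
  set x := p (pathType (n + 1) hk0) with hx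
  have hx0 : 0 ≤ x := limitProfiles_nonneg hp _
  have hx1 : x ≤ 1 := limitProfiles_le_one hp _
  set θ := 1 - ε / n with hθ
  have hεθ : ε / n = 1 - θ := by rw [hθ]; ring
  have hθ0 : 0 < θ := by
    rw [hθ, sub_pos, div_lt_one hn0]
    exact hεn
  have hθ1 : θ ≤ 1 := by
    rw [hθ]
    have : 0 ≤ ε / n := by positivity
    linarith
  have he : 2 ≤ Real.exp 1 := by linarith [Real.exp_one_gt_d9]
  have hfac : (1 : ℝ) ≤ (n ! : ℝ) := by exact_mod_cast Nat.factorial_pos n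
  have hpow : (1 : ℝ) ≤ (n : ℝ) ^ ε := Real.one_le_rpow (by linarith) hε0.le
  have hxθ : x ≤ x ^ θ := by
    rcases hx0.eq_or_lt with h | h
    · rw [← h]
      positivity
    · have := Real.rpow_le_rpow_of_exponent_ge h hx1 hθ1
      rwa [Real.rpow_one] at this
  have hp2 : 0 ≤ p (starType (n + 1) hk0) := limitProfiles_nonneg hp _
  have hprod : 1 ≤ (n ! : ℝ) * (n : ℝ) ^ ε := one_le_mul_of_one_le_of_one_le hfac hpow
  -- If `x` is not small, the right-hand side is not positive.
  rcases le_total (1 / 2) x with hx2 | hx2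
  · have h1 : 2 * 1 * (1 / 2) ≤ Real.exp 1 * ((n ! : ℝ) * (n : ℝ) ^ ε) * x ^ θ := by
      gcongr
      exact hx2.trans hxθ
    rw [← mul_assoc] at h1
    linarith
  have hmain := one_sub_le_of_mem_limitProfiles (by omega) hε0 hε1 hεn hεq
    (by positivity : (0 : ℝ) ≤ (n : ℝ) ^ n) (by positivity : (0 : ℝ) ≤ (n : ℝ) ^ n)
    (pow_le_pow_self_mul_choose_add n) (Nat.cast_le.2 (card_shapes_le n)) hk0 hp
  rw [← hx, ← hθ] at hmain
  have h1 : (2 * x) ^ θ * ((n : ℝ) ^ n + (n : ℝ) ^ n * (2 * x)) ^ (ε / n) ≤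
      2 * x ^ θ * (n : ℝ) ^ ε := by
    have h2 : (n : ℝ) ^ n + (n : ℝ) ^ n * (2 * x) = (n : ℝ) ^ n * (1 + 2 * x) := by ring
    have h3 : ((n : ℝ) ^ n) ^ (ε / n) = (n : ℝ) ^ ε := by
      rw [← Real.rpow_natCast, ← Real.rpow_mul hn0.le, mul_div_cancel₀ _ hn0.ne']
    have h4 : (1 + 2 * x) ^ (ε / n) ≤ 2 ^ (ε / n) :=
      Real.rpow_le_rpow (by linarith) (by linarith) (by positivity)
    have h5 : (2 : ℝ) ^ θ * 2 ^ (ε / n) = 2 := by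
      rw [← Real.rpow_add two_pos, hεθ, add_sub_cancel, Real.rpow_one]
    rw [h2, Real.mul_rpow (by positivity : (0 : ℝ) ≤ (n : ℝ) ^ n) (by linarith), h3,
      Real.mul_rpow two_pos.le hx0]
    calc (2 : ℝ) ^ θ * x ^ θ * ((n : ℝ) ^ ε * (1 + 2 * x) ^ (ε / n))
        ≤ 2 ^ θ * x ^ θ * ((n : ℝ) ^ ε * 2 ^ (ε / n)) := by gcongr
      _ = (2 ^ θ * 2 ^ (ε / n)) * x ^ θ * (n : ℝ) ^ ε := by ring
      _ = 2 * x ^ θ * (n : ℝ) ^ ε := by rw [h5]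
  have h2 : (n ! : ℝ) * (2 * x ^ θ * (n : ℝ) ^ ε) ≤
      Real.exp 1 * (n ! : ℝ) * (n : ℝ) ^ ε * x ^ θ := by
    have h3 : 2 * ((n ! : ℝ) * (n : ℝ) ^ ε * x ^ θ) ≤
        Real.exp 1 * ((n ! : ℝ) * (n : ℝ) ^ ε * x ^ θ) := by gcongr
    linarith
  have h3 := mul_le_mul_of_nonneg_left h1 (by positivity : (0 : ℝ) ≤ n !)
  linarith

/-- The explicit bound for `k = 5`; its exponent `2 + √3` is the larger root of
`ε + 1 / ε = 4`, the smallest exponent allowed by `card_descents_le`. -/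
theorem starType_ge_of_five (hk0 : 0 < 5) {p : TreeType 5 → ℝ}
    (hp : p ∈ limitProfiles 5) :
    p (starType 5 hk0) ≥ 1 - p (pathType 5 hk0) -
      2 * (4 : ℝ) ^ (2 + √3 : ℝ) * p (pathType 5 hk0) ^ ((2 - √3) / 4 : ℝ) := by
  have hs2 : √3 ^ 2 = 3 := Real.sq_sqrt (by norm_num)
  have hs0 : 0 ≤ √3 := Real.sqrt_nonneg _
  have hs1 : 1.7 ≤ √3 := Real.le_sqrt_of_sq_le (by norm_num)
  have hs3 : √3 < 2 := by nlinarith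
  obtain ⟨ε, hε⟩ : ∃ ε, ε = 2 + √3 := ⟨_, rfl⟩
  obtain ⟨θ, hθ⟩ : ∃ θ, θ = (2 - √3) / 4 := ⟨_, rfl⟩
  have hε0 : 0 < ε := by linarith
  have hεq : ((4 : ℕ) : ℝ) ≤ ε + 1 / ε := by
    have h1 : (4 - ε) * ε ≤ 1 := by
      rw [hε]
      nlinarith
    rw [← le_div_iff₀ hε0] at h1
    push_cast
    linarith
  have hmain := one_sub_le_of_mem_limitProfiles (n := 4) (C := 15) (by omega) hε0
    (by push_cast; linarith) (by push_cast; linarith) hεq (by norm_num : (0 : ℝ) ≤ 25)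
    (by norm_num : (0 : ℝ) ≤ 300 ^ 4) pow_four_le_choose_add
    (by exact_mod_cast card_shapes_four_le) hk0 hp
  rw [← hε, ← hθ]
  have hθε : 1 - ε / (4 : ℕ) = θ := by
    rw [hθ, hε]
    push_cast
    ring
  have hθε' : ε / (4 : ℕ) = 1 - θ := by linarith
  rw [hθε, hθε'] at hmain
  change 1 - p (starType 5 _) ≤ _ at hmain
  set x := p (pathType 5 hk0) with hx
  have hx0 : 0 ≤ x := limitProfiles_nonneg hp _
  have hx1 : x ≤ 1 := limitProfiles_le_one hp _
  have hp2 : 0 ≤ p (starType 5 hk0) := limitProfiles_nonneg hp _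
  have hθ0 : 0 < θ := by linarith
  have hθ1 : θ ≤ 1 / 13 := by linarith
  have hxθ0 : 0 ≤ x ^ θ := Real.rpow_nonneg hx0 _
  -- If `x` is not tiny, the right-hand side is not positive.
  rcases le_total (1 / 128) (x ^ θ) with hxθ | hxθ
  · have h1 : (64 : ℝ) ≤ 4 ^ ε := by
      have h2 : (4 : ℝ) ^ (3 : ℝ) ≤ 4 ^ ε :=
        Real.rpow_le_rpow_of_exponent_le (by norm_num) (by linarith)
      refine le_trans (le_of_eq ?_) h2
      rw [show (3 : ℝ) = (3 : ℕ) by norm_num, Real.rpow_natCast]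
      norm_num
    have h2 : 2 * 64 * (1 / 128) ≤ 2 * (4 : ℝ) ^ ε * x ^ θ := by gcongr
    linarith
  have hxtiny : 300 ^ 4 * (2 * x) ≤ 1 := by
    have h1 : x ≤ (x ^ θ) ^ 13 := by
      rcases hx0.eq_or_lt with h | h
      · rw [← h]
        positivity
      · have h13 : θ * (13 : ℕ) ≤ 1 := by
          push_cast
          linarith
        have h2 := Real.rpow_le_rpow_of_exponent_ge h hx1 h13
        rwa [Real.rpow_one, Real.rpow_mul hx0, Real.rpow_natCast] at h2
    have h2 : (x ^ θ) ^ 13 ≤ (1 / 128) ^ 13 := by gcongr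
    have h3 : (300 : ℝ) ^ 4 * (2 * (1 / 128) ^ 13) ≤ 1 := by norm_num
    linarith
  -- As `4 ^ ε = 256 ^ (1 - θ)`, `hconst` amounts to `390 * (256 / 13) ^ θ ≤ 512`.
  have h20 : (256 / 13 : ℝ) ^ θ ≤ 1.3 := by
    calc (256 / 13 : ℝ) ^ θ ≤ (1.3 ^ 13) ^ θ :=
          Real.rpow_le_rpow (by norm_num) (by norm_num) hθ0.le
      _ ≤ (1.3 ^ 13) ^ (1 / 13 : ℝ) :=
          Real.rpow_le_rpow_of_exponent_le (by norm_num) hθ1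
      _ = 1.3 := by
          rw [← Real.rpow_natCast, ← Real.rpow_mul (by norm_num)]
          norm_num
  have hconst : 15 * ((2 : ℝ) ^ θ * 26 ^ (1 - θ)) ≤ 2 * 4 ^ ε := by
    have h1 : (4 : ℝ) ^ ε = 256 / 256 ^ θ := by
      rw [show ε = 4 * (1 - θ) by rw [← hθε']; push_cast; ring, Real.rpow_mul (by norm_num),
        show (4 : ℝ) ^ (4 : ℝ) = 256 by
          rw [show (4 : ℝ) ^ (4 : ℝ) = (4 : ℝ) ^ (4 : ℕ) by norm_cast]; norm_num,
        Real.rpow_sub (by norm_num), Real.rpow_one]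
    have h2 : (26 : ℝ) ^ (1 - θ) = 26 / (2 ^ θ * 13 ^ θ) := by
      rw [Real.rpow_sub (by norm_num), Real.rpow_one, ← Real.mul_rpow (by norm_num) (by norm_num)]
      norm_num
    have h3 : (256 / 13 : ℝ) ^ θ = 256 ^ θ / 13 ^ θ := Real.div_rpow (by norm_num) (by norm_num) _
    have h4 : (0 : ℝ) < 256 ^ θ := by positivity
    have h5 : (0 : ℝ) < 13 ^ θ := by positivity
    have h6 : (0 : ℝ) < 2 ^ θ := by positivity
    rw [h3, div_le_iff₀ h5] at h20
    have h7 : (2 : ℝ) ^ θ * (26 / (2 ^ θ * 13 ^ θ)) = 26 / 13 ^ θ := by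
      field_simp
    rw [h1, h2, h7, mul_div_assoc', mul_div_assoc', div_le_div_iff₀ h5 h4]
    linarith
  have h1 : (2 * x) ^ θ * (25 + 300 ^ 4 * (2 * x)) ^ (1 - θ) ≤
      (2 ^ θ * 26 ^ (1 - θ)) * x ^ θ := by
    rw [Real.mul_rpow two_pos.le hx0]
    have h2 : (25 + 300 ^ 4 * (2 * x)) ^ (1 - θ) ≤ (26 : ℝ) ^ (1 - θ) :=
      Real.rpow_le_rpow (by positivity) (by linarith) (by linarith)
    calc 2 ^ θ * x ^ θ * (25 + 300 ^ 4 * (2 * x)) ^ (1 - θ)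
        ≤ 2 ^ θ * x ^ θ * 26 ^ (1 - θ) := by gcongr
      _ = (2 ^ θ * 26 ^ (1 - θ)) * x ^ θ := by ring
  have h2 := mul_le_mul_of_nonneg_right hconst hxθ0
  linarith

theorem starType_ge_one {k : ℕ} (hk : 5 ≤ k) (hk0 : 0 < k) {p : TreeType k → ℝ}
    (hp : p ∈ limitProfiles k)
    (h0 : p (pathType k hk0) = 0) : 1 ≤ p (starType k hk0) := by
  rcases hk.eq_or_lt with rfl | hk
  · have h := starType_ge_of_five hk0 hp
    have hs : √3 < 2 := (Real.sqrt_lt' two_pos).2 (by norm_num)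
    rw [h0, Real.zero_rpow (by linarith)] at h
    linarith
  · have h := starType_ge_of_six_le hk hk0 hp
    have hne : 1 - starExponent k / ((k : ℝ) - 1) ≠ 0 := by
      have hk' : (6 : ℝ) ≤ k := by exact_mod_cast hk
      have hs : √(((k : ℝ) - 2) ^ 2 + 4 * ((k : ℝ) - 2)) < k := by
        rw [Real.sqrt_lt' (by linarith)]
        nlinarith
      have : starExponent k / ((k : ℝ) - 1) < 1 := by
        rw [div_lt_one (by linarith), starExponent]
        linarith
      linarith
    rw [h0, Real.zero_rpow hne] at h
    linarith

/-- Every subsequence of the profiles has a limiting profile, by compactness, and `starType_ge_one`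
applies to it. -/
theorem tendsto_starType {k : ℕ} (hk : 5 ≤ k) (hk0 : 0 < k) (T : ℕ → FinTree)
    (hT : Tendsto (fun n => (T n).order) atTop atTop)
    (hpath : Tendsto (fun n => treeProfile k (T n) (pathType k hk0)) atTop (𝓝 0)) :
    Tendsto (fun n => treeProfile k (T n) (starType k hk0)) atTop (𝓝 1) := by
  refine tendsto_of_subseq_tendsto fun ns hns => ?_
  have hcpt : IsCompact (Set.univ.pi fun _ : TreeType k => Set.Icc (0 : ℝ) 1) :=
    isCompact_univ_pi fun _ => isCompact_Icc
  obtain ⟨p, -, ms, hms, hp⟩ := hcpt.tendsto_subseq (x := fun m => treeProfile k (T (ns m)))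
    fun m R _ => ⟨by unfold treeProfile; positivity, treeProfile_le_one _ _⟩
  have hsub : Tendsto (fun m => ns (ms m)) atTop atTop := hns.comp hms.tendsto_atTop
  have hmem : p ∈ limitProfiles k := ⟨fun m => T (ns (ms m)), hT.comp hsub, hp⟩
  have h0 : p (pathType k hk0) = 0 :=
    tendsto_nhds_unique (tendsto_pi_nhds.1 hp _) (hpath.comp hsub)
  have h1 : p (starType k hk0) = 1 :=
    le_antisymm (limitProfiles_le_one hmem _) (starType_ge_one hk hk0 hmem h0)
  exact ⟨ms, h1 ▸ tendsto_pi_nhds.1 hp _⟩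

theorem theorem2 :
    (∀ (k : ℕ) (hk : 6 ≤ k), ∀ p ∈ limitProfiles k,
      p (starType k (by omega)) ≥
        1 - Real.exp 1 * ((k - 1)! : ℝ) * ((k : ℝ) - 1) ^ starExponent k *
          p (pathType k (by omega)) ^ (1 - starExponent k / ((k : ℝ) - 1))) ∧
    (∀ p ∈ limitProfiles 5,
      p (starType 5 (by omega)) ≥
        1 - p (pathType 5 (by omega)) -
          2 * (4 : ℝ) ^ (2 + √3 : ℝ) * p (pathType 5 (by omega)) ^ ((2 - √3) / 4 : ℝ)) ∧
    (∀ (k : ℕ) (hk : 5 ≤ k) (T : ℕ → FinTree),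
      Tendsto (fun n => (T n).order) atTop atTop →
      Tendsto (fun n => treeProfile k (T n) (pathType k (by omega))) atTop (𝓝 0) →
      Tendsto (fun n => treeProfile k (T n) (starType k (by omega))) atTop (𝓝 1)) :=
  ⟨fun _ hk _ hp => starType_ge_of_six_le hk _ hp, fun _ hp => starType_ge_of_five _ hp,
    fun _ hk T hT hpath => tendsto_starType hk _ T hT hpath⟩
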